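/- Let $\Lambda>0$, $H=\sqrt{\Lambda/3}$, $a\in\mathbb R$, and let $M:\mathbb R\to\mathbb R$ be a $C^3$ function. On the coordinate domain $\{(\tilde v,r,\vartheta,\tilde\psi)\in\mathbb R^4 : r>0,\ 0<\vartheta<\pi\}$ put $$\rho^2=r^2+a^2\cos^2\vartheta,\quad \Gamma=r^2+a^2,\quad \Delta_\Lambda=r^2-2M(\tilde v)r+a^2-\Gamma r^2H^2,\quad \Theta=1+H^2a^2\cos^2\vartheta,\quad Z=1+H^2a^2,$$ and let $\tilde g$ be the Kerr-Vaidya-de Sitter metric $$ds^2=-\frac{\Delta_\Lambda-\Theta a^2\sin^2\vartheta}{\rho^2Z^2}\,d\tilde v^2+\frac{2}{Z}\,d\tilde v\,dr-\frac{2a\sin^2\vartheta}{\rho^2Z^2}(\Gamma\Theta-\Delta_\Lambda)\,d\tilde v\,d\tilde\psi-\frac{2a\sin^2\vartheta}{Z}\,dr\,d\tilde\psi+\frac{\rho^2}{\Theta}\,d\vartheta^2+\frac{\sin^2\vartheta}{\rho^2Z^2}\left(\Gamma^2\Theta-\Delta_\Lambda a^2\sin^2\vartheta\right)d\tilde\psi^2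 .$$ Let $\nabla$ be its Levi-Civita connection, $\tilde G_{ab}=R_{ab}-\tfrac12R\,\tilde g_{ab}$ its Einstein tensor, and $\tilde K=\partial/\partial\tilde v$. Then $\tilde K$ generates a Kodama-like time translation symmetry, that is, everywhere on the domain: 1. $\tilde K$ is divergence-free: $\nabla_a\tilde K^a=0$. 2. $\tilde K$ is tangent to the surfaces of constant $r$: $\tilde K^a\nabla_a r=0$. 3. The current $\tilde J^a=\tilde G^{ab}\tilde K_b$ is differentiable and covariantly conserved: $\nabla_a\tilde J^a=0$. Moreover, $\tilde K$ is timelike ($\tilde K^a\tilde K_a<0$) exactly where $\Delta_\Lambda>\Theta a^2\sin^2\vartheta$, and $\tilde K^a\tilde K_a=0$ exactly where $\Delta_\Lambda=\Theta a^2\sin^2\vartheta$. If $a\neq0$, then $\tilde K^a\tilde K_a>0$ wherever $\Delta_\Lambda=0$, and the set $\{\tilde K^a\tilde K_a=0\}$ does not coincide with the set $\{\Delta_\Lambda=0\}$. -/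

import Mathlib

/-! ## Tensor calculus in a coordinate chart -/

namespace ChartGeometry

/-- The partial derivative `∂_μ f` at `x`. -/
noncomputable def partialDeriv {n : ℕ} (μ : Fin n) (f : (Fin n → ℝ) → ℝ) (x : Fin n → ℝ) : ℝ :=
  deriv (fun t => f (Function.update x μ t)) (x μ)

variable {n : ℕ} (g : (Fin n → ℝ) → Matrix (Fin n) (Fin n) ℝ)

/-- The Christoffel symbol
`Γ^l_{μν} = (1/2) g^{lσ} (∂_μ g_{σν} + ∂_ν g_{σμ} - ∂_σ g_{μν})` of the metric `g`. -/
noncomputable def christoffel (l μ ν : Fin n) (x : Fin n → ℝ) : ℝ :=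
  (1 / 2) * ∑ σ, (g x)⁻¹ l σ *
    (partialDeriv μ (fun y => g y σ ν) x + partialDeriv ν (fun y => g y σ μ) x
      - partialDeriv σ (fun y => g y μ ν) x)

/-- The Riemann tensor
`R^l_{κμν} = ∂_μ Γ^l_{νκ} - ∂_ν Γ^l_{μκ} + Γ^l_{μσ} Γ^σ_{νκ} - Γ^l_{νσ} Γ^σ_{μκ}`. -/
noncomputable def riemann (l κ μ ν : Fin n) (x : Fin n → ℝ) : ℝ :=
  partialDeriv μ (christoffel g l ν κ) x - partialDeriv ν (christoffel g l μ κ) x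
    + ∑ σ, (christoffel g l μ σ x * christoffel g σ ν κ x
        - christoffel g l ν σ x * christoffel g σ μ κ x)

/-- The Ricci tensor `R_{μν} = R^l_{μlν}`. -/
noncomputable def ricci (μ ν : Fin n) (x : Fin n → ℝ) : ℝ :=
  ∑ l, riemann g l μ l ν x

/-- The Ricci scalar `R = g^{μν} R_{μν}`. -/
noncomputable def scalarCurvature (x : Fin n → ℝ) : ℝ :=
  ∑ μ, ∑ ν, (g x)⁻¹ μ ν * ricci g μ ν x

/-- The Einstein tensor `G_{μν} = R_{μν} - (1/2) R g_{μν}`. -/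
noncomputable def einstein (μ ν : Fin n) (x : Fin n → ℝ) : ℝ :=
  ricci g μ ν x - (1 / 2) * scalarCurvature g x * g x μ ν

/-- The Einstein tensor with both indices raised, `G^{μν} = g^{μα} g^{νβ} G_{αβ}`. -/
noncomputable def einsteinUp (μ ν : Fin n) (x : Fin n → ℝ) : ℝ :=
  ∑ α, ∑ β, (g x)⁻¹ μ α * (g x)⁻¹ ν β * einstein g α β x

/-- The covector `K_μ = g_{μν} K^ν` of a vector field `K`. -/
noncomputable def lowerIndex (K : (Fin n → ℝ) → Fin n → ℝ) (x : Fin n → ℝ) (μ : Fin n) : ℝ :=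
  ∑ ν, g x μ ν * K x ν

/-- The norm `K^μ K_μ` of a vector field `K`. -/
noncomputable def normSq (K : (Fin n → ℝ) → Fin n → ℝ) (x : Fin n → ℝ) : ℝ :=
  ∑ μ, K x μ * lowerIndex g K x μ

/-- The current `J^μ = G^{μν} K_ν` generated by a vector field `K`. -/
noncomputable def einsteinCurrent (K : (Fin n → ℝ) → Fin n → ℝ) (x : Fin n → ℝ) (μ : Fin n) : ℝ :=
  ∑ ν, einsteinUp g μ ν x * lowerIndex g K x ν

/-- The covariant derivative `∇_μ V^ν = ∂_μ V^ν + Γ^ν_{μσ} V^σ` of a vector field `V`. -/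
noncomputable def covDeriv (V : (Fin n → ℝ) → Fin n → ℝ) (μ ν : Fin n) (x : Fin n → ℝ) : ℝ :=
  partialDeriv μ (fun y => V y ν) x + ∑ σ, christoffel g ν μ σ x * V x σ

/-- The covariant divergence `∇_μ V^μ` of a vector field `V`. -/
noncomputable def divergence (V : (Fin n → ℝ) → Fin n → ℝ) (x : Fin n → ℝ) : ℝ :=
  ∑ μ, covDeriv g V μ μ x

/-- The derivative `K^μ ∇_μ f` of a function `f` along a vector field `K`. -/
noncomputable def derivAlong (K : (Fin n → ℝ) → Fin n → ℝ) (f : (Fin n → ℝ) → ℝ)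
    (x : Fin n → ℝ) : ℝ :=
  ∑ μ, K x μ * partialDeriv μ f x

end ChartGeometry

/-! ## The Kerr-Vaidya-de Sitter metric

The coordinates are `x = (v, r, θ, ψ) = (x 0, x 1, x 2, x 3)`. -/

namespace KerrVaidyaDeSitter

/-- The coordinate domain `r > 0`, `0 < θ < π`. The angle `ψ` is left unrestricted, as nothing
depends on it. -/
def domain : Set (Fin 4 → ℝ) :=
  {x | 0 < x 1 ∧ 0 < x 2 ∧ x 2 < Real.pi}

/-- The Hubble constant `H = √(Λ / 3)`. -/
noncomputable def hubble (Λ : ℝ) : ℝ := Real.sqrt (Λ / 3)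

/-- `ρ² = r² + a² cos² θ`. -/
noncomputable def rhoSq (a : ℝ) (x : Fin 4 → ℝ) : ℝ :=
  x 1 ^ 2 + a ^ 2 * Real.cos (x 2) ^ 2

/-- `Γ = r² + a²`. -/
noncomputable def Gam (a : ℝ) (x : Fin 4 → ℝ) : ℝ := x 1 ^ 2 + a ^ 2

/-- `Δ_Λ = Δ - Γ r² H²`, where `Δ = r² - 2 M(v) r + a²`. -/
noncomputable def DeltaL (Λ a : ℝ) (M : ℝ → ℝ) (x : Fin 4 → ℝ) : ℝ :=
  (x 1 ^ 2 - 2 * M (x 0) * x 1 + a ^ 2) - Gam a x * x 1 ^ 2 * hubble Λ ^ 2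

/-- `Θ = 1 + H² a² cos² θ`. -/
noncomputable def Theta (Λ a : ℝ) (x : Fin 4 → ℝ) : ℝ :=
  1 + hubble Λ ^ 2 * a ^ 2 * Real.cos (x 2) ^ 2

/-- `Z = 1 + H² a²`. -/
noncomputable def Zc (Λ a : ℝ) : ℝ := 1 + hubble Λ ^ 2 * a ^ 2

/-- `g_vv`, the coefficient of `dv²`. -/
noncomputable def gvv (Λ a : ℝ) (M : ℝ → ℝ) (x : Fin 4 → ℝ) : ℝ :=
  -((DeltaL Λ a M x - Theta Λ a x * a ^ 2 * Real.sin (x 2) ^ 2) / (rhoSq a x * Zc Λ a ^ 2))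

/-- `g_vψ`, half the coefficient of `dv dψ`. -/
noncomputable def gvpsi (Λ a : ℝ) (M : ℝ → ℝ) (x : Fin 4 → ℝ) : ℝ :=
  -(a * Real.sin (x 2) ^ 2 / (rhoSq a x * Zc Λ a ^ 2) * (Gam a x * Theta Λ a x - DeltaL Λ a M x))

/-- `g_rψ`, half the coefficient of `dr dψ`. -/
noncomputable def grpsi (Λ a : ℝ) (x : Fin 4 → ℝ) : ℝ :=
  -(a * Real.sin (x 2) ^ 2 / Zc Λ a)

/-- `g_ψψ`, the coefficient of `dψ²`. -/
noncomputable def gpsipsi (Λ a : ℝ) (M : ℝ → ℝ) (x : Fin 4 → ℝ) : ℝ :=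
  Real.sin (x 2) ^ 2 / (rhoSq a x * Zc Λ a ^ 2) *
    (Gam a x ^ 2 * Theta Λ a x - DeltaL Λ a M x * a ^ 2 * Real.sin (x 2) ^ 2)

/-- The Kerr-Vaidya-de Sitter metric with cosmological constant `Λ`, rotation parameter `a` and
mass function `M`, as the matrix of its components in the coordinates `(v, r, θ, ψ)`. -/
noncomputable def metric (Λ a : ℝ) (M : ℝ → ℝ) (x : Fin 4 → ℝ) : Matrix (Fin 4) (Fin 4) ℝ :=
  !![gvv Λ a M x,   1 / Zc Λ a,  0,                      gvpsi Λ a M x;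
     1 / Zc Λ a,    0,           0,                      grpsi Λ a x;
     0,             0,           rhoSq a x / Theta Λ a x, 0;
     gvpsi Λ a M x, grpsi Λ a x, 0,                      gpsipsi Λ a M x]

/-- The vector field `∂/∂v`. -/
def kodamaField (_ : Fin 4 → ℝ) : Fin 4 → ℝ := Pi.single 0 1

/-- The determinant of the metric is `-(ρ² sin θ / Z²)²`, so that on `domain` the metric is
nondegenerate and its matrix inverse is the true inverse metric. -/
theorem det_metric (Λ a : ℝ) (M : ℝ → ℝ) (x : Fin 4 → ℝ) (hx : x ∈ domain) :
    (metric Λ a M x).det = -(rhoSq a x * Real.sin (x 2) / Zc Λ a ^ 2) ^ 2 := by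
  have h1 : rhoSq a x ≠ 0 := by
    have := hx.1
    unfold rhoSq
    positivity
  have h2 : Theta Λ a x ≠ 0 := by
    unfold Theta
    positivity
  have h3 : Zc Λ a ≠ 0 := by
    unfold Zc
    positivity
  have hc : Real.cos (x 2) ^ 2 = 1 - Real.sin (x 2) ^ 2 := Real.cos_sq' (x 2)
  have hG : Gam a x = rhoSq a x + a ^ 2 * Real.sin (x 2) ^ 2 := by
    unfold Gam rhoSq
    rw [hc]
    ring
  rw [metric, Matrix.det_succ_row_zero]
  simp [Fin.sum_univ_succ, Matrix.det_fin_three, Fin.succAbove, gvv, gvpsi, grpsi, gpsipsi, hG]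
  field_simp
  ring

end KerrVaidyaDeSitter

/-! Put `α = Δ_Λ / (ρ² Z²)`, `β = Θ sin² θ / (ρ² Z²)`, `k = dv - a sin² θ dψ` and `m = a dv - Γ dψ`.
The metric is `-α k² + (2/Z) k dr + (ρ²/Θ) dθ² + β m²`, and `v` enters only through `α`. Hence `∂_v
g = -(∂_v α) k ⊗ k`, while raising the index of `k` gives `Z ∂_r`, a null vector.

For a coordinate field `K = ∂_b` one has `∇_a K^a = (1/2) g^{ac} ∂_b g_{ac}`. The contracted Bianchi
identity also gives `∇_a (G^a_c K^c) = (1/2) G^{ac} ∂_b g_{ac}`. With `b = v` the first is a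
multiple of `k(∂_r) = 0` and the second a multiple of `G_rr`. Since `g_rr = 0`, everything reduces
to `R_rr = 0`.

The curves along `∂_r` are affine geodesics, so `R_rr = -∂_r tr A - tr A²` with `A = (Γ^l_{rκ})`.
Both traces can be read off after conjugating `A` by the coframe, and they cancel
(`ricci_one_one_metric`). No Einstein component other than `G_rr` is computed.

The Bianchi identities are proved for any `C³` metric by treating connection and curvature as
matrices, so that they become noncommutative ring identities plus symmetry of second derivatives. A
`C³` metric has a `C²` connection and a `C¹` Einstein tensor, which makes the current
differentiable.

The causal statements follow from the formula for `g_vv` (`normSq_kodamaField`); that the two loci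
differ needs a zero of `Δ_Λ` (`exists_DeltaL_eq_zero`). -/

namespace ChartGeometry

open Matrix Filter Topology

/-! ### Partial derivatives along coordinate lines and their Fréchet counterparts. -/

section PartialDeriv

variable {n : ℕ} {f g : (Fin n → ℝ) → ℝ} {x : Fin n → ℝ}

theorem hasDerivAt_comp_update (hf : DifferentiableAt ℝ f x) (μ : Fin n) :
    HasDerivAt (fun t => f (Function.update x μ t)) (fderiv ℝ f x (Pi.single μ 1)) (x μ) := by
  have h : HasDerivAt (Function.update x μ) (Pi.single μ 1) (x μ) := hasDerivAt_update x μ (x μ)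
  have hf' : HasFDerivAt f (fderiv ℝ f x) (Function.update x μ (x μ)) := by
    rw [Function.update_eq_self]
    exact hf.hasFDerivAt
  exact hf'.comp_hasDerivAt (x μ) h

theorem partialDeriv_eq_fderiv (hf : DifferentiableAt ℝ f x) (μ : Fin n) :
    partialDeriv μ f x = fderiv ℝ f x (Pi.single μ 1) :=
  (hasDerivAt_comp_update hf μ).deriv

theorem partialDeriv_congr (h : f =ᶠ[𝓝 x] g) (μ : Fin n) :
    partialDeriv μ f x = partialDeriv μ g x := by
  have hc : Tendsto (fun t => Function.update x μ t) (𝓝 (x μ)) (𝓝 x) := by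
    have : Continuous fun t : ℝ => Function.update x μ t :=
      continuous_const.update μ continuous_id
    simpa using this.tendsto (x μ)
  exact Filter.EventuallyEq.deriv_eq (hc.eventually h)

theorem partialDeriv_const (c : ℝ) (μ : Fin n) : partialDeriv μ (fun _ => c) x = 0 := by
  simp [partialDeriv]

theorem partialDeriv_add (hf : DifferentiableAt ℝ f x) (hg : DifferentiableAt ℝ g x)
    (μ : Fin n) :
    partialDeriv μ (fun y => f y + g y) x = partialDeriv μ f x + partialDeriv μ g x := by
  rw [partialDeriv_eq_fderiv hf, partialDeriv_eq_fderiv hg, partialDeriv_eq_fderiv (hf.fun_add hg),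
    fderiv_fun_add hf hg]
  rfl

theorem partialDeriv_neg (μ : Fin n) :
    partialDeriv μ (fun y => -f y) x = -partialDeriv μ f x := by
  simp [partialDeriv]

theorem partialDeriv_sub (hf : DifferentiableAt ℝ f x) (hg : DifferentiableAt ℝ g x)
    (μ : Fin n) :
    partialDeriv μ (fun y => f y - g y) x = partialDeriv μ f x - partialDeriv μ g x := by
  simp only [sub_eq_add_neg]
  rw [partialDeriv_add hf hg.fun_neg, partialDeriv_neg]

theorem partialDeriv_mul (hf : DifferentiableAt ℝ f x) (hg : DifferentiableAt ℝ g x)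
    (μ : Fin n) :
    partialDeriv μ (fun y => f y * g y) x = partialDeriv μ f x * g x + f x * partialDeriv μ g x := by
  rw [partialDeriv_eq_fderiv hf, partialDeriv_eq_fderiv hg, partialDeriv_eq_fderiv (hf.fun_mul hg),
    fderiv_fun_mul hf hg]
  simp
  ring

theorem partialDeriv_sum {ι : Type*} (s : Finset ι) {F : ι → (Fin n → ℝ) → ℝ}
    (hF : ∀ i ∈ s, DifferentiableAt ℝ (F i) x) (μ : Fin n) :
    partialDeriv μ (fun y => ∑ i ∈ s, F i y) x = ∑ i ∈ s, partialDeriv μ (F i) x := by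
  have h : DifferentiableAt ℝ (fun y => ∑ i ∈ s, F i y) x := DifferentiableAt.fun_sum hF
  rw [partialDeriv_eq_fderiv h, fderiv_fun_sum hF]
  simp only [_root_.sum_apply]
  exact Finset.sum_congr rfl fun i hi => (partialDeriv_eq_fderiv (hF i hi) μ).symm

theorem partialDeriv_inv (hf : DifferentiableAt ℝ f x) (hx : f x ≠ 0) (μ : Fin n) :
    partialDeriv μ (fun y => (f y)⁻¹) x = -partialDeriv μ f x / f x ^ 2 := by
  rw [partialDeriv_eq_fderiv hf]
  have h := (hasDerivAt_comp_update hf μ).fun_inv (by simpa using hx)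
  rw [Function.update_eq_self] at h
  exact h.deriv

/-- Differentiating a partial derivative again requires the identification with `fderiv` on a whole
neighbourhood; finite positive smoothness at a point supplies one. -/
theorem partialDeriv_eventuallyEq {k : ℕ} (hf : ContDiffAt ℝ (k + 1 : ℕ) f x) (μ : Fin n) :
    partialDeriv μ f =ᶠ[𝓝 x] fun y => fderiv ℝ f y (Pi.single μ 1) := by
  filter_upwards [hf.eventually (by simp)] with y hy
  exact partialDeriv_eq_fderiv (hy.differentiableAt (by simp)) μ

theorem contDiffAt_partialDeriv {k : ℕ} (hf : ContDiffAt ℝ (k + 1 : ℕ) f x) (μ : Fin n) :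
    ContDiffAt ℝ k (partialDeriv μ f) x := by
  refine ContDiffAt.congr_of_eventuallyEq ?_ (partialDeriv_eventuallyEq hf μ)
  exact (hf.fderiv_right (m := k) (by simp)).clm_apply contDiffAt_const

theorem partialDeriv_comm (hf : ContDiffAt ℝ 2 f x) (μ ν : Fin n) :
    partialDeriv μ (partialDeriv ν f) x = partialDeriv ν (partialDeriv μ f) x := by
  have hd : DifferentiableAt ℝ (fderiv ℝ f) x :=
    (hf.fderiv_right (m := 1) (by norm_num)).differentiableAt (by simp)
  have key : ∀ μ ν : Fin n, partialDeriv μ (partialDeriv ν f) x =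
      fderiv ℝ (fderiv ℝ f) x (Pi.single μ 1) (Pi.single ν 1) := by
    intro μ ν
    rw [partialDeriv_congr (partialDeriv_eventuallyEq (k := 1) (by exact_mod_cast hf) ν),
      partialDeriv_eq_fderiv (hd.clm_apply (differentiableAt_const _)),
      fderiv_clm_apply hd (differentiableAt_const _)]
    simp
  rw [key, key]
  exact (hf.isSymmSndFDerivAt (by simp)).eq _ _

end PartialDeriv

/-! ### Differential calculus of matrix-valued functions. -/

/-- The entrywise partial derivative of a matrix valued function. -/
noncomputable def matDeriv {n : ℕ} (μ : Fin n) (F : (Fin n → ℝ) → Matrix (Fin n) (Fin n) ℝ)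
    (x : Fin n → ℝ) : Matrix (Fin n) (Fin n) ℝ :=
  Matrix.of fun i j => partialDeriv μ (fun y => F y i j) x

/-- All entries of the matrix valued function `F` are `C^k` at `x`. -/
def MatContDiffAt {n : ℕ} (k : ℕ) (F : (Fin n → ℝ) → Matrix (Fin n) (Fin n) ℝ)
    (x : Fin n → ℝ) : Prop :=
  ∀ i j, ContDiffAt ℝ k (fun y => F y i j) x

section MatDeriv

variable {n k : ℕ} {F G : (Fin n → ℝ) → Matrix (Fin n) (Fin n) ℝ} {x : Fin n → ℝ}

theorem matDeriv_apply (μ i j : Fin n) :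
    matDeriv μ F x i j = partialDeriv μ (fun y => F y i j) x := rfl

namespace MatContDiffAt

theorem mono {m : ℕ} (hF : MatContDiffAt k F x) (hm : m ≤ k) : MatContDiffAt m F x :=
  fun i j => (hF i j).of_le (by exact_mod_cast hm)

theorem differentiableAt (hF : MatContDiffAt (k + 1) F x) (i j : Fin n) :
    DifferentiableAt ℝ (fun y => F y i j) x :=
  (hF i j).differentiableAt (by simp)

theorem add (hF : MatContDiffAt k F x) (hG : MatContDiffAt k G x) :
    MatContDiffAt k (fun y => F y + G y) x :=
  fun i j => (hF i j).add (hG i j)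

theorem sub (hF : MatContDiffAt k F x) (hG : MatContDiffAt k G x) :
    MatContDiffAt k (fun y => F y - G y) x :=
  fun i j => (hF i j).sub (hG i j)

theorem mul (hF : MatContDiffAt k F x) (hG : MatContDiffAt k G x) :
    MatContDiffAt k (fun y => F y * G y) x := by
  intro i j
  simp only [Matrix.mul_apply]
  exact ContDiffAt.sum fun s _ => (hF i s).mul (hG s j)

theorem transpose (hF : MatContDiffAt k F x) : MatContDiffAt k (fun y => (F y)ᵀ) x :=
  fun i j => hF j i

theorem matDeriv (hF : MatContDiffAt (k + 1) F x) (μ : Fin n) :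
    MatContDiffAt k (matDeriv μ F) x :=
  fun i j => contDiffAt_partialDeriv (hF i j) μ

theorem det (hF : MatContDiffAt k F x) : ContDiffAt ℝ k (fun y => (F y).det) x := by
  simp only [Matrix.det_apply]
  exact ContDiffAt.sum fun σ _ => (contDiffAt_prod fun i _ => hF (σ i) i).const_smul _

/-- Cramer's rule: each entry of the inverse is a quotient of determinants, and determinants are
polynomial in the entries. -/
theorem inv (hF : MatContDiffAt k F x) (hd : (F x).det ≠ 0) :
    MatContDiffAt k (fun y => (F y)⁻¹) x := by
  intro i j
  simp only [Matrix.inv_def, Ring.inverse_eq_inv', Matrix.smul_apply, smul_eq_mul,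
    Matrix.adjugate_apply]
  refine (hF.det.inv hd).mul (MatContDiffAt.det (F := fun y => (F y).updateRow j _) ?_)
  intro p q
  by_cases h : p = j
  · subst h
    simp only [Matrix.updateRow_self]
    exact contDiffAt_const
  · simp only [Matrix.updateRow_ne h]
    exact hF p q

end MatContDiffAt

theorem matDeriv_congr (h : F =ᶠ[𝓝 x] G) (μ : Fin n) : matDeriv μ F x = matDeriv μ G x := by
  ext i j
  exact partialDeriv_congr (f := fun y => F y i j) (g := fun y => G y i j)
    (h.mono fun y hy => congrFun (congrFun hy i) j) μ

theorem matDeriv_const (A : Matrix (Fin n) (Fin n) ℝ) (μ : Fin n) :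
    matDeriv μ (fun _ => A) x = 0 := by
  ext i j
  exact partialDeriv_const _ μ

theorem matDeriv_transpose (μ : Fin n) : matDeriv μ (fun y => (F y)ᵀ) x = (matDeriv μ F x)ᵀ := rfl

theorem matDeriv_add (hF : MatContDiffAt 1 F x) (hG : MatContDiffAt 1 G x) (μ : Fin n) :
    matDeriv μ (fun y => F y + G y) x = matDeriv μ F x + matDeriv μ G x := by
  ext i j
  exact partialDeriv_add (hF.differentiableAt i j) (hG.differentiableAt i j) μ

theorem matDeriv_sub (hF : MatContDiffAt 1 F x) (hG : MatContDiffAt 1 G x) (μ : Fin n) :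
    matDeriv μ (fun y => F y - G y) x = matDeriv μ F x - matDeriv μ G x := by
  ext i j
  exact partialDeriv_sub (hF.differentiableAt i j) (hG.differentiableAt i j) μ

theorem matDeriv_neg (μ : Fin n) :
    matDeriv μ (fun y => -F y) x = -matDeriv μ F x := by
  ext i j
  exact partialDeriv_neg (f := fun y => F y i j) μ

theorem matDeriv_mul (hF : MatContDiffAt 1 F x) (hG : MatContDiffAt 1 G x) (μ : Fin n) :
    matDeriv μ (fun y => F y * G y) x = matDeriv μ F x * G x + F x * matDeriv μ G x := by
  ext i j
  simp only [matDeriv_apply, Matrix.mul_apply, Matrix.add_apply]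
  rw [partialDeriv_sum _ fun s _ => (hF.differentiableAt i s).fun_mul (hG.differentiableAt s j),
    ← Finset.sum_add_distrib]
  exact Finset.sum_congr rfl fun s _ =>
    partialDeriv_mul (hF.differentiableAt i s) (hG.differentiableAt s j) μ

theorem matDeriv_comm (hF : MatContDiffAt 2 F x) (μ ν : Fin n) :
    matDeriv μ (matDeriv ν F) x = matDeriv ν (matDeriv μ F) x := by
  ext i j
  exact partialDeriv_comm (hF i j) μ ν

end MatDeriv

/-! ### The Levi-Civita connection, its curvature and the Bianchi identities. -/

/-- `g` is a `C^3` nondegenerate symmetric matrix valued function on the open set `U`. -/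
structure IsMetricOn {n : ℕ} (g : (Fin n → ℝ) → Matrix (Fin n) (Fin n) ℝ)
    (U : Set (Fin n → ℝ)) : Prop where
  isOpen : IsOpen U
  contDiffAt : ∀ x ∈ U, MatContDiffAt 3 g x
  symm : ∀ x ∈ U, (g x)ᵀ = g x
  det_ne_zero : ∀ x ∈ U, (g x).det ≠ 0

variable {n : ℕ} (g : (Fin n → ℝ) → Matrix (Fin n) (Fin n) ℝ)

/-- The Christoffel symbols of the first kind as matrices,
`(Γ_μ)_{σν} = (1/2) (∂_μ g_{σν} + ∂_ν g_{σμ} - ∂_σ g_{μν})`. -/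
noncomputable def lowerConnection (μ : Fin n) (x : Fin n → ℝ) : Matrix (Fin n) (Fin n) ℝ :=
  Matrix.of fun σ ν => (1 / 2) * (partialDeriv μ (fun y => g y σ ν) x
    + partialDeriv ν (fun y => g y σ μ) x - partialDeriv σ (fun y => g y μ ν) x)

/-- The connection matrices `(A_μ)^l_κ = Γ^l_{μκ}`. -/
noncomputable def connection (μ : Fin n) (x : Fin n → ℝ) : Matrix (Fin n) (Fin n) ℝ :=
  Matrix.of fun l κ => christoffel g l μ κ x

/-- The curvature matrices `(F_{μν})^l_κ = R^l_{κμν}`. -/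
noncomputable def curvature (μ ν : Fin n) (x : Fin n → ℝ) : Matrix (Fin n) (Fin n) ℝ :=
  Matrix.of fun l κ => riemann g l κ μ ν x

theorem connection_eq (μ : Fin n) (x : Fin n → ℝ) :
    connection g μ x = (g x)⁻¹ * lowerConnection g μ x := by
  ext l κ
  simp only [connection, lowerConnection, christoffel, Matrix.mul_apply, Matrix.of_apply,
    Finset.mul_sum]
  exact Finset.sum_congr rfl fun σ _ => by ring

/-- This is `F = dA + A ∧ A`; in this form the curvature identities can be left to noncommutative
algebra. -/
theorem curvature_eq (μ ν : Fin n) (x : Fin n → ℝ) :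
    curvature g μ ν x = matDeriv μ (connection g ν) x - matDeriv ν (connection g μ) x
      + (connection g μ x * connection g ν x - connection g ν x * connection g μ x) := by
  ext l κ
  simp only [curvature, riemann, Matrix.of_apply, Matrix.add_apply, Matrix.sub_apply,
    Matrix.mul_apply, Finset.sum_sub_distrib]
  rfl

theorem ricci_eq (μ ν : Fin n) (x : Fin n → ℝ) : ricci g μ ν x = ∑ l, curvature g l ν x l μ := rfl

variable {g} {U : Set (Fin n → ℝ)} {x : Fin n → ℝ}

namespace IsMetricOn

theorem eventually (hg : IsMetricOn g U) (hx : x ∈ U) : ∀ᶠ y in 𝓝 x, y ∈ U :=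
  hg.isOpen.mem_nhds hx

theorem isUnit_det (hg : IsMetricOn g U) (hx : x ∈ U) : IsUnit (g x).det :=
  (hg.det_ne_zero x hx).isUnit

theorem apply_symm (hg : IsMetricOn g U) (hx : x ∈ U) (i j : Fin n) : g x i j = g x j i :=
  congrFun (congrFun (hg.symm x hx) j) i

theorem inv_symm (hg : IsMetricOn g U) (hx : x ∈ U) : ((g x)⁻¹)ᵀ = (g x)⁻¹ := by
  rw [Matrix.transpose_nonsing_inv, hg.symm x hx]

theorem contDiffAt_inv (hg : IsMetricOn g U) (hx : x ∈ U) :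
    MatContDiffAt 3 (fun y => (g y)⁻¹) x :=
  (hg.contDiffAt x hx).inv (hg.det_ne_zero x hx)

theorem partialDeriv_symm (hg : IsMetricOn g U) (hx : x ∈ U) (μ i j : Fin n) :
    partialDeriv μ (fun y => g y i j) x = partialDeriv μ (fun y => g y j i) x :=
  partialDeriv_congr ((hg.eventually hx).mono fun _ hy => hg.apply_symm hy i j) μ

theorem contDiffAt_lowerConnection (hg : IsMetricOn g U) (hx : x ∈ U) (μ : Fin n) :
    MatContDiffAt 2 (lowerConnection g μ) x := by
  have h := fun μ => MatContDiffAt.matDeriv (k := 2) (hg.contDiffAt x hx) μ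
  intro i j
  exact contDiffAt_const.mul (((h μ i j).add (h j i μ)).sub (h i μ j))

theorem contDiffAt_connection (hg : IsMetricOn g U) (hx : x ∈ U) (μ : Fin n) :
    MatContDiffAt 2 (connection g μ) x := by
  have h : connection g μ = fun y => (g y)⁻¹ * lowerConnection g μ y :=
    funext fun y => connection_eq g μ y
  rw [h]
  exact ((hg.contDiffAt_inv hx).mono (by norm_num)).mul (hg.contDiffAt_lowerConnection hx μ)

theorem contDiffAt_curvature (hg : IsMetricOn g U) (hx : x ∈ U) (μ ν : Fin n) :
    MatContDiffAt 1 (curvature g μ ν) x := by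
  have h := fun μ => hg.contDiffAt_connection hx μ
  have h1 := fun μ => (h μ).mono (m := 1) (by norm_num)
  rw [show curvature g μ ν = _ from funext fun y => curvature_eq g μ ν y]
  exact (((h ν).matDeriv μ).sub ((h μ).matDeriv ν)).add
    (((h1 μ).mul (h1 ν)).sub ((h1 ν).mul (h1 μ)))

theorem mul_connection (hg : IsMetricOn g U) (hx : x ∈ U) (μ : Fin n) :
    g x * connection g μ x = lowerConnection g μ x := by
  rw [connection_eq, Matrix.mul_nonsing_inv_cancel_left _ _ (hg.isUnit_det hx)]

/-- The Levi-Civita connection is torsion free. -/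
theorem christoffel_symm (hg : IsMetricOn g U) (hx : x ∈ U) (l μ ν : Fin n) :
    christoffel g l μ ν x = christoffel g l ν μ x := by
  simp only [christoffel]
  congr 1
  refine Finset.sum_congr rfl fun σ _ => ?_
  rw [hg.partialDeriv_symm hx σ μ ν]
  ring

/-- The Levi-Civita connection is compatible with the metric. -/
theorem matDeriv_metric (hg : IsMetricOn g U) (hx : x ∈ U) (μ : Fin n) :
    matDeriv μ g x = g x * connection g μ x + (connection g μ x)ᵀ * g x := by
  have h : (connection g μ x)ᵀ * g x = (lowerConnection g μ x)ᵀ := by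
    rw [← hg.mul_connection hx, Matrix.transpose_mul, hg.symm x hx]
  rw [h, hg.mul_connection hx]
  ext i j
  simp only [matDeriv_apply, lowerConnection, Matrix.add_apply, Matrix.transpose_apply,
    Matrix.of_apply]
  rw [hg.partialDeriv_symm hx μ j i, hg.partialDeriv_symm hx i j μ, hg.partialDeriv_symm hx j i μ]
  ring

theorem matDeriv_inv_eq_neg_mul (hg : IsMetricOn g U) (hx : x ∈ U) (μ : Fin n) :
    matDeriv μ (fun y => (g y)⁻¹) x = -((g x)⁻¹ * matDeriv μ g x * (g x)⁻¹) := by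
  have h := matDeriv_mul ((hg.contDiffAt_inv hx).mono (m := 1) (by norm_num))
    ((hg.contDiffAt x hx).mono (m := 1) (by norm_num)) μ
  have h1 : (fun y => (g y)⁻¹ * g y) =ᶠ[𝓝 x] fun _ => 1 :=
    (hg.eventually hx).mono fun y hy => Matrix.nonsing_inv_mul _ (hg.isUnit_det hy)
  rw [matDeriv_congr h1, matDeriv_const] at h
  have h2 := congrArg (· * (g x)⁻¹) h
  simp only [Matrix.zero_mul, Matrix.add_mul,
    Matrix.mul_nonsing_inv_cancel_right _ _ (hg.isUnit_det hx)] at h2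
  exact eq_neg_of_add_eq_zero_left h2.symm

/-- Metric compatibility for the inverse metric, `∇ g⁻¹ = 0`, solved for the partial derivative. -/
theorem matDeriv_inv (hg : IsMetricOn g U) (hx : x ∈ U) (μ : Fin n) :
    matDeriv μ (fun y => (g y)⁻¹) x =
      -(connection g μ x * (g x)⁻¹ + (g x)⁻¹ * (connection g μ x)ᵀ) := by
  rw [hg.matDeriv_inv_eq_neg_mul hx, hg.matDeriv_metric hx, Matrix.mul_add, Matrix.add_mul,
    Matrix.nonsing_inv_mul_cancel_left _ _ (hg.isUnit_det hx), ← Matrix.mul_assoc,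
    Matrix.mul_nonsing_inv_cancel_right _ _ (hg.isUnit_det hx)]

theorem matDeriv_connection_comm (hg : IsMetricOn g U) (hx : x ∈ U) (μ ν κ : Fin n) :
    matDeriv μ (matDeriv ν (connection g κ)) x = matDeriv ν (matDeriv μ (connection g κ)) x :=
  matDeriv_comm (hg.contDiffAt_connection hx κ) μ ν

theorem curvature_antisymm (μ ν : Fin n) : curvature g ν μ x = -curvature g μ ν x := by
  rw [curvature_eq, curvature_eq]
  abel

theorem matDeriv_matDeriv_inv (hg : IsMetricOn g U) (hx : x ∈ U) (μ ν : Fin n) :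
    matDeriv μ (matDeriv ν fun y => (g y)⁻¹) x =
      -(matDeriv μ (connection g ν) x * (g x)⁻¹
        + connection g ν x * matDeriv μ (fun y => (g y)⁻¹) x
        + (matDeriv μ (fun y => (g y)⁻¹) x * (connection g ν x)ᵀ
          + (g x)⁻¹ * (matDeriv μ (connection g ν) x)ᵀ)) := by
  have hA : MatContDiffAt 1 (connection g ν) x :=
    (hg.contDiffAt_connection hx ν).mono (by norm_num)
  have hh : MatContDiffAt 1 (fun y => (g y)⁻¹) x := (hg.contDiffAt_inv hx).mono (by norm_num)
  rw [matDeriv_congr ((hg.eventually hx).mono fun y hy => hg.matDeriv_inv hy ν), matDeriv_neg,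
    matDeriv_add (hA.mul hh) (hh.mul hA.transpose), matDeriv_mul hA hh,
    matDeriv_mul hh hA.transpose, matDeriv_transpose]

/-- The curvature with its second index raised is antisymmetric in the first pair of indices. -/
theorem curvature_mul_inv_antisymm (hg : IsMetricOn g U) (hx : x ∈ U) (μ ν : Fin n) :
    (curvature g μ ν x * (g x)⁻¹)ᵀ = -(curvature g μ ν x * (g x)⁻¹) := by
  -- Commuting second derivatives of `g⁻¹` express `[∇_μ, ∇_ν] g⁻¹ = 0`. Once `∂ g⁻¹` is eliminated,
  -- what survives is, up to sign, `F g⁻¹ + (F g⁻¹)ᵀ`.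
  have h := matDeriv_comm ((hg.contDiffAt_inv hx).mono (m := 2) (by norm_num)) μ ν
  rw [hg.matDeriv_matDeriv_inv hx, hg.matDeriv_matDeriv_inv hx, hg.matDeriv_inv hx,
    hg.matDeriv_inv hx] at h
  rw [Matrix.transpose_mul, hg.inv_symm hx, eq_neg_iff_add_eq_zero, curvature_eq]
  simp only [Matrix.transpose_add, Matrix.transpose_sub, Matrix.transpose_mul]
  rw [← sub_eq_zero] at h
  rw [← neg_eq_zero, ← h]
  noncomm_ring

/-- The trace pairs the antisymmetric `F g⁻¹` with the symmetric `g`. -/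
theorem trace_curvature (hg : IsMetricOn g U) (hx : x ∈ U) (μ ν : Fin n) :
    (curvature g μ ν x).trace = 0 := by
  have h := hg.curvature_mul_inv_antisymm hx μ ν
  have h1 : (curvature g μ ν x * (g x)⁻¹ * g x) = curvature g μ ν x :=
    Matrix.nonsing_inv_mul_cancel_right _ _ (hg.isUnit_det hx)
  have h2 : (curvature g μ ν x).trace = -(curvature g μ ν x).trace := by
    calc (curvature g μ ν x).trace
        = ((curvature g μ ν x * (g x)⁻¹ * g x)ᵀ).trace := by rw [Matrix.trace_transpose, h1]
      _ = -(curvature g μ ν x).trace := by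
          rw [Matrix.transpose_mul, h, hg.symm x hx, Matrix.mul_neg, Matrix.trace_neg,
            Matrix.trace_mul_comm, h1]
  linarith

/-- The first Bianchi identity. -/
theorem first_bianchi (hg : IsMetricOn g U) (hx : x ∈ U) (l κ μ ν : Fin n) :
    curvature g μ ν x l κ + curvature g ν κ x l μ + curvature g κ μ x l ν = 0 := by
  have hs : ∀ α β σ, partialDeriv σ (christoffel g l α β) x
      = partialDeriv σ (christoffel g l β α) x := fun α β σ =>
    partialDeriv_congr ((hg.eventually hx).mono fun y hy => hg.christoffel_symm hy l α β) σ
  simp only [curvature, riemann, Matrix.of_apply, Finset.sum_sub_distrib]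
  -- Torsion-freeness brings the lower indices to a common order, after which all derivative and
  -- quadratic terms cancel in pairs.
  rw [hs κ ν, hs κ μ, hs ν μ]
  simp only [fun σ => hg.christoffel_symm hx σ κ ν, fun σ => hg.christoffel_symm hx σ κ μ,
    fun σ => hg.christoffel_symm hx σ ν μ]
  ring

/-- The second Bianchi identity. -/
theorem second_bianchi (hg : IsMetricOn g U) (hx : x ∈ U) (lam μ ν : Fin n) :
    (matDeriv lam (curvature g μ ν) x
        + (connection g lam x * curvature g μ ν x - curvature g μ ν x * connection g lam x))
      + (matDeriv μ (curvature g ν lam) x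
        + (connection g μ x * curvature g ν lam x - curvature g ν lam x * connection g μ x))
      + (matDeriv ν (curvature g lam μ) x
        + (connection g ν x * curvature g lam μ x - curvature g lam μ x * connection g ν x))
      = 0 := by
  have hA := fun μ => hg.contDiffAt_connection hx μ
  have hA1 := fun μ => (hA μ).mono (m := 1) (by norm_num)
  have hd : ∀ κ α β, matDeriv κ (curvature g α β) x
      = matDeriv κ (matDeriv α (connection g β)) x - matDeriv κ (matDeriv β (connection g α)) x
        + ((matDeriv κ (connection g α) x * connection g β x
            + connection g α x * matDeriv κ (connection g β) x)
          - (matDeriv κ (connection g β) x * connection g α x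
            + connection g β x * matDeriv κ (connection g α) x)) := by
    intro κ α β
    rw [show curvature g α β = _ from funext fun y => curvature_eq g α β y,
      matDeriv_add (((hA β).matDeriv α).sub ((hA α).matDeriv β))
        (((hA1 α).mul (hA1 β)).sub ((hA1 β).mul (hA1 α))),
      matDeriv_sub ((hA β).matDeriv α) ((hA α).matDeriv β),
      matDeriv_sub ((hA1 α).mul (hA1 β)) ((hA1 β).mul (hA1 α)),
      matDeriv_mul (hA1 α) (hA1 β), matDeriv_mul (hA1 β) (hA1 α)]
  -- Only the second derivatives of `A` need analysis; once they commute, the rest is the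
  -- Jacobi-type cancellation of `d_A F = 0`.
  rw [hd, hd, hd, hg.matDeriv_connection_comm hx lam μ ν, hg.matDeriv_connection_comm hx lam ν μ,
    hg.matDeriv_connection_comm hx μ ν lam]
  simp only [curvature_eq]
  noncomm_ring

/-- The Ricci tensor is symmetric. -/
theorem ricci_symm (hg : IsMetricOn g U) (hx : x ∈ U) (μ ν : Fin n) :
    ricci g μ ν x = ricci g ν μ x := by
  -- Contracting the first Bianchi identity gives `R_{μν} + tr F_{νμ} - R_{νμ} = 0`, and the trace
  -- term vanishes.
  have h : ∑ l, (curvature g l ν x l μ + curvature g ν μ x l l + curvature g μ l x l ν) = 0 :=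
    Finset.sum_eq_zero fun l _ => hg.first_bianchi hx l μ l ν
  have ht : ∑ l, curvature g ν μ x l l = 0 := hg.trace_curvature hx ν μ
  rw [Finset.sum_add_distrib, Finset.sum_add_distrib, ht] at h
  simp only [curvature_antisymm _ μ, Matrix.neg_apply, Finset.sum_neg_distrib] at h
  rw [ricci_eq, ricci_eq]
  linarith

end IsMetricOn

/-! ### The twice contracted Bianchi identity. -/

/-- The connection terms of the divergence of a tensor antisymmetric in both pairs of indices. -/
theorem sum_connection_mul_curvature {A : Fin n → Matrix (Fin n) (Fin n) ℝ}
    {Q : Fin n → Fin n → Matrix (Fin n) (Fin n) ℝ}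
    (hA : ∀ l μ ν, A μ l ν = A ν l μ) (hQ : ∀ μ ν, (Q μ ν)ᵀ = -Q μ ν)
    {S : Matrix (Fin n) (Fin n) ℝ} (hS : ∀ k b, S k b = ∑ l, Q l b l k) (b : Fin n) :
    ∑ l, ∑ k, (A l * Q k b + Q k b * (A l)ᵀ) l k = -∑ l, ∑ s, A l l s * S s b := by
  have hQe : ∀ μ ν i j, Q μ ν i j = -Q μ ν j i := fun μ ν i j => by
    simpa using congrFun (congrFun (hQ μ ν) j) i
  have h1 : ∑ l, ∑ k, (A l * Q k b) l k = -∑ l, ∑ s, A l l s * S s b := by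
    simp only [Matrix.mul_apply, hS, Finset.mul_sum, ← Finset.sum_neg_distrib]
    refine Finset.sum_congr rfl fun l _ => ?_
    rw [Finset.sum_comm]
    refine Finset.sum_congr rfl fun s _ => Finset.sum_congr rfl fun k _ => ?_
    rw [hQe k b s k]
    ring
  -- `Γ^k_{ls}` is symmetric in `l, s` and `Q_{kb}^{ls}` is antisymmetric, so the double sum equals
  -- its own negative.
  have h2 : ∑ l, ∑ k, (Q k b * (A l)ᵀ) l k = 0 := by
    have h : ∀ k, ∑ l, (Q k b * (A l)ᵀ) l k = 0 := by
      intro k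
      simp only [Matrix.mul_apply, Matrix.transpose_apply]
      have h : ∑ l, ∑ s, Q k b l s * A l k s = -∑ l, ∑ s, Q k b l s * A l k s := by
        refine Finset.sum_comm.trans ?_
        simp only [← Finset.sum_neg_distrib]
        refine Finset.sum_congr rfl fun l _ => Finset.sum_congr rfl fun s _ => ?_
        rw [hQe k b s l, hA k s l]
        ring
      linarith
    rw [Finset.sum_comm]
    exact Finset.sum_eq_zero fun k _ => h k
  simp only [Matrix.add_apply, Finset.sum_add_distrib]
  rw [h1, h2, add_zero]

/-- The connection terms of the gradient of the full trace of a tensor antisymmetric in both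
pairs of indices. -/
theorem sum_connection_mul_curvature_trace (A : Matrix (Fin n) (Fin n) ℝ)
    {Q : Fin n → Fin n → Matrix (Fin n) (Fin n) ℝ} (hQ : ∀ μ ν, (Q μ ν)ᵀ = -Q μ ν)
    (hQ' : ∀ μ ν, Q ν μ = -Q μ ν) {S : Matrix (Fin n) (Fin n) ℝ}
    (hS : ∀ k b, S k b = ∑ l, Q l b l k) :
    ∑ l, ∑ k, (A * Q l k + Q l k * Aᵀ) l k = 2 * (A * S).trace := by
  have hQe : ∀ μ ν i j, Q μ ν i j = Q ν μ j i := fun μ ν i j => by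
    rw [hQ' μ ν, ← hQ μ ν]
    rfl
  have h3 : ∑ l, ∑ k, (A * Q l k) l k = (A * S).trace := by
    simp only [Matrix.trace, Matrix.diag, Matrix.mul_apply, hS, Finset.mul_sum]
    refine Finset.sum_congr rfl fun l _ => ?_
    rw [Finset.sum_comm]
    exact Finset.sum_congr rfl fun s _ => Finset.sum_congr rfl fun k _ => by rw [hQe l k]
  have h4 : ∑ l, ∑ k, (Q l k * Aᵀ) l k = ∑ l, ∑ k, (A * Q l k) l k := by
    rw [Finset.sum_comm]
    refine Finset.sum_congr rfl fun l _ => Finset.sum_congr rfl fun k _ => ?_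
    simp only [Matrix.mul_apply, Matrix.transpose_apply]
    exact Finset.sum_congr rfl fun s _ => by rw [hQe k l, mul_comm]
  simp only [Matrix.add_apply, Finset.sum_add_distrib]
  rw [h4, h3]
  ring

/-- The Ricci tensor as a matrix. -/
noncomputable def ricciMatrix (g : (Fin n → ℝ) → Matrix (Fin n) (Fin n) ℝ) (x : Fin n → ℝ) :
    Matrix (Fin n) (Fin n) ℝ :=
  Matrix.of fun μ ν => ricci g μ ν x

/-- The Einstein tensor as a matrix. -/
noncomputable def einsteinMatrix (g : (Fin n → ℝ) → Matrix (Fin n) (Fin n) ℝ) (x : Fin n → ℝ) :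
    Matrix (Fin n) (Fin n) ℝ :=
  Matrix.of fun μ ν => einstein g μ ν x

theorem einsteinMatrix_eq : einsteinMatrix g x =
    ricciMatrix g x - (1 / 2 * scalarCurvature g x) • g x := rfl

namespace IsMetricOn

theorem ricciMatrix_transpose (hg : IsMetricOn g U) (hx : x ∈ U) :
    (ricciMatrix g x)ᵀ = ricciMatrix g x := by
  ext i j
  exact hg.ricci_symm hx j i

theorem einsteinMatrix_transpose (hg : IsMetricOn g U) (hx : x ∈ U) :
    (einsteinMatrix g x)ᵀ = einsteinMatrix g x := by
  rw [einsteinMatrix_eq, Matrix.transpose_sub, Matrix.transpose_smul, hg.ricciMatrix_transpose hx,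
    hg.symm x hx]

theorem scalarCurvature_eq_trace (hg : IsMetricOn g U) (hx : x ∈ U) :
    scalarCurvature g x = ((g x)⁻¹ * ricciMatrix g x).trace := by
  simp only [scalarCurvature, Matrix.trace, Matrix.diag, Matrix.mul_apply]
  exact Finset.sum_congr rfl fun μ _ => Finset.sum_congr rfl fun ν _ => by
    rw [hg.ricci_symm hx]; rfl

theorem inv_mul_einsteinMatrix (hg : IsMetricOn g U) (hx : x ∈ U) :
    (g x)⁻¹ * einsteinMatrix g x =
      (g x)⁻¹ * ricciMatrix g x - (1 / 2 * scalarCurvature g x) • 1 := by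
  rw [einsteinMatrix_eq, Matrix.mul_sub, Matrix.mul_smul,
    Matrix.nonsing_inv_mul _ (hg.isUnit_det hx)]

/-- The mixed Ricci tensor is the contraction `R^k_b = R^{lk}_{lb}`, which allows it to be extracted
from the raised Bianchi identity. -/
theorem inv_mul_ricciMatrix_apply (hg : IsMetricOn g U) (hx : x ∈ U) (k b : Fin n) :
    ((g x)⁻¹ * ricciMatrix g x) k b = ∑ l, (curvature g l b x * (g x)⁻¹) l k := by
  simp only [Matrix.mul_apply, ricciMatrix, Matrix.of_apply, ricci_eq, Finset.mul_sum]
  rw [Finset.sum_comm]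
  refine Finset.sum_congr rfl fun l _ => Finset.sum_congr rfl fun s _ => ?_
  rw [mul_comm, ← congrFun (congrFun (hg.inv_symm hx) s) k]
  rfl

theorem contDiffAt_ricciMatrix (hg : IsMetricOn g U) (hx : x ∈ U) :
    MatContDiffAt 1 (ricciMatrix g) x := by
  intro i j
  have h : ContDiffAt ℝ 1 (fun y => ∑ l, curvature g l j y l i) x :=
    ContDiffAt.sum fun l _ => hg.contDiffAt_curvature hx l j l i
  exact h

theorem contDiffAt_inv_mul_ricciMatrix (hg : IsMetricOn g U) (hx : x ∈ U) :
    MatContDiffAt 1 (fun y => (g y)⁻¹ * ricciMatrix g y) x :=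
  ((hg.contDiffAt_inv hx).mono (by norm_num)).mul (hg.contDiffAt_ricciMatrix hx)

theorem contDiffAt_scalarCurvature (hg : IsMetricOn g U) (hx : x ∈ U) :
    ContDiffAt ℝ 1 (scalarCurvature g) x :=
  ContDiffAt.sum fun i _ => ContDiffAt.sum fun j _ =>
    (((hg.contDiffAt_inv hx).mono (m := 1) (by norm_num)) i j).mul
      (hg.contDiffAt_ricciMatrix hx i j)

theorem contDiffAt_inv_mul_einsteinMatrix (hg : IsMetricOn g U) (hx : x ∈ U) :
    MatContDiffAt 1 (fun y => (g y)⁻¹ * einsteinMatrix g y) x := by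
  refine ((hg.contDiffAt_inv hx).mono (by norm_num)).mul
    ((hg.contDiffAt_ricciMatrix hx).sub fun i j => ?_)
  exact (contDiffAt_const.mul (hg.contDiffAt_scalarCurvature hx)).mul
    ((hg.contDiffAt x hx).mono (m := 1) (by norm_num) i j)

theorem contDiffAt_curvature_mul_inv (hg : IsMetricOn g U) (hx : x ∈ U) (μ ν : Fin n) :
    MatContDiffAt 1 (fun y => curvature g μ ν y * (g y)⁻¹) x :=
  (hg.contDiffAt_curvature hx μ ν).mul ((hg.contDiffAt_inv hx).mono (by norm_num))

/-- The second Bianchi identity for the curvature with its second index raised. -/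
theorem second_bianchi_mul_inv (hg : IsMetricOn g U) (hx : x ∈ U) (lam μ ν : Fin n) :
    (matDeriv lam (fun y => curvature g μ ν y * (g y)⁻¹) x
        + (connection g lam x * (curvature g μ ν x * (g x)⁻¹)
          + curvature g μ ν x * (g x)⁻¹ * (connection g lam x)ᵀ))
      + (matDeriv μ (fun y => curvature g ν lam y * (g y)⁻¹) x
        + (connection g μ x * (curvature g ν lam x * (g x)⁻¹)
          + curvature g ν lam x * (g x)⁻¹ * (connection g μ x)ᵀ))
      + (matDeriv ν (fun y => curvature g lam μ y * (g y)⁻¹) x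
        + (connection g ν x * (curvature g lam μ x * (g x)⁻¹)
          + curvature g lam μ x * (g x)⁻¹ * (connection g ν x)ᵀ))
      = 0 := by
  have hd : ∀ κ α β, matDeriv κ (fun y => curvature g α β y * (g y)⁻¹) x =
      matDeriv κ (curvature g α β) x * (g x)⁻¹ + curvature g α β x *
        -(connection g κ x * (g x)⁻¹ + (g x)⁻¹ * (connection g κ x)ᵀ) := fun κ α β => by
    rw [matDeriv_mul (hg.contDiffAt_curvature hx α β)
      ((hg.contDiffAt_inv hx).mono (by norm_num)), hg.matDeriv_inv hx]
  have h := congrArg (· * (g x)⁻¹) (hg.second_bianchi hx lam μ ν)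
  simp only [Matrix.zero_mul] at h
  rw [hd, hd, hd, ← h]
  noncomm_ring

/-- The twice contracted second Bianchi identity for the Ricci tensor. -/
theorem contracted_bianchi_ricci (hg : IsMetricOn g U) (hx : x ∈ U) (b : Fin n) :
    ∑ l, (partialDeriv l (fun y => ((g y)⁻¹ * ricciMatrix g y) l b) x
        + ∑ s, christoffel g l l s x * ((g x)⁻¹ * ricciMatrix g x) s b) =
      (connection g b x * ((g x)⁻¹ * ricciMatrix g x)).trace
        + 1 / 2 * partialDeriv b (scalarCurvature g) x := by
  set Q : Fin n → Fin n → (Fin n → ℝ) → Matrix (Fin n) (Fin n) ℝ :=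
    fun μ ν y => curvature g μ ν y * (g y)⁻¹ with hQdef
  have hQd : ∀ μ ν, MatContDiffAt 1 (Q μ ν) x := hg.contDiffAt_curvature_mul_inv hx
  have hQ : ∀ y ∈ U, ∀ μ ν, (Q μ ν y)ᵀ = -Q μ ν y := fun y hy =>
    hg.curvature_mul_inv_antisymm hy
  have hQ' : ∀ y, ∀ μ ν, Q ν μ y = -Q μ ν y := fun y μ ν => by
    simp only [hQdef]
    rw [curvature_antisymm, Matrix.neg_mul]
  have hS : ∀ y ∈ U, ∀ k b, ((g y)⁻¹ * ricciMatrix g y) k b = ∑ l, Q l b y l k :=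
    fun y hy => hg.inv_mul_ricciMatrix_apply hy
  have hA : ∀ l μ ν, connection g μ x l ν = connection g ν x l μ :=
    fun l μ ν => hg.christoffel_symm hx l μ ν
  -- The sign comes from the upper pair: `Q_{kb}^{lk} = -Q_{kb}^{kl}`, which contracts to `-R^l_b`.
  have hd1 : ∑ l, ∑ k, matDeriv l (Q k b) x l k =
      -∑ l, partialDeriv l (fun y => ((g y)⁻¹ * ricciMatrix g y) l b) x := by
    rw [← Finset.sum_neg_distrib]
    refine Finset.sum_congr rfl fun l _ => ?_
    simp only [matDeriv_apply]
    rw [← partialDeriv_sum _ fun k _ => (hQd k b).differentiableAt l k, ← partialDeriv_neg]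
    refine partialDeriv_congr ((hg.eventually hx).mono fun y hy => ?_) l
    simp only [hS y hy, ← Finset.sum_neg_distrib]
    exact Finset.sum_congr rfl fun k _ => congrFun (congrFun (hQ y hy k b) k) l
  have hd2 : ∑ l, ∑ k, matDeriv b (Q l k) x l k = partialDeriv b (scalarCurvature g) x := by
    simp only [matDeriv_apply]
    have h : scalarCurvature g =ᶠ[𝓝 x] fun y => ∑ l, ∑ k, Q l k y l k := by
      filter_upwards [hg.eventually hx] with y hy
      rw [hg.scalarCurvature_eq_trace hy, Finset.sum_comm]
      exact Finset.sum_congr rfl fun k _ => hS y hy k k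
    rw [partialDeriv_congr h, partialDeriv_sum _ fun l _ =>
      DifferentiableAt.fun_sum fun k _ => (hQd l k).differentiableAt l k]
    exact Finset.sum_congr rfl fun l _ =>
      (partialDeriv_sum _ (fun k _ => (hQd l k).differentiableAt l k) b).symm
  have hc := sum_connection_mul_curvature (A := fun μ => connection g μ x)
    (Q := fun μ ν => Q μ ν x) hA (hQ x hx) (hS x hx) b
  have hc' := sum_connection_mul_curvature_trace (connection g b x)
    (Q := fun μ ν => Q μ ν x) (hQ x hx) (hQ' x) (hS x hx)
  -- The `(l, k)` entry of the Bianchi identity. Flipping both antisymmetric pairs, `Q_{bl}^{lk} =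
  -- Q_{lb}^{kl}`, makes the second cyclic term the first with `l` and `k` exchanged, so the two
  -- have equal sums. This doubling is the source of the factor `1/2`.
  have hB : ∀ l k, matDeriv l (Q k b) x l k + matDeriv k (Q l b) x k l + matDeriv b (Q l k) x l k
      + (connection g l x * Q k b x + Q k b x * (connection g l x)ᵀ) l k
      + (connection g k x * Q l b x + Q l b x * (connection g k x)ᵀ) k l
      + (connection g b x * Q l k x + Q l k x * (connection g b x)ᵀ) l k = 0 := by
    intro l k
    have h := congrFun (congrFun (hg.second_bianchi_mul_inv hx l k b) l) k
    have e1 : matDeriv k (Q b l) x l k = matDeriv k (Q l b) x k l := by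
      refine partialDeriv_congr (f := fun y => Q b l y l k) (g := fun y => Q l b y k l)
        ((hg.eventually hx).mono fun y hy => ?_) k
      simp only [hQ' y l b]
      exact (congrFun (congrFun (hQ y hy l b) l) k).symm
    have e2 : (connection g k x * Q b l x + Q b l x * (connection g k x)ᵀ) l k =
        (connection g k x * Q l b x + Q l b x * (connection g k x)ᵀ) k l := by
      have e : (connection g k x * Q b l x + Q b l x * (connection g k x)ᵀ) =
        (connection g k x * Q l b x + Q l b x * (connection g k x)ᵀ)ᵀ := by
        rw [Matrix.transpose_add, Matrix.transpose_mul (M := connection g k x),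
          Matrix.transpose_mul (N := (connection g k x)ᵀ), Matrix.transpose_transpose,
          hQ x hx, hQ' x l b, add_comm]
      rw [e, Matrix.transpose_apply]
    have h' : matDeriv l (Q k b) x l k
        + (connection g l x * Q k b x + Q k b x * (connection g l x)ᵀ) l k
      + (matDeriv k (Q b l) x l k
        + (connection g k x * Q b l x + Q b l x * (connection g k x)ᵀ) l k)
      + (matDeriv b (Q l k) x l k
        + (connection g b x * Q l k x + Q l k x * (connection g b x)ᵀ) l k) = 0 := h
    rw [e1, e2] at h'
    linarith
  have hsum : ∑ l, ∑ k, (matDeriv l (Q k b) x l k + matDeriv k (Q l b) x k l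
      + matDeriv b (Q l k) x l k
      + (connection g l x * Q k b x + Q k b x * (connection g l x)ᵀ) l k
      + (connection g k x * Q l b x + Q l b x * (connection g k x)ᵀ) k l
      + (connection g b x * Q l k x + Q l k x * (connection g b x)ᵀ) l k) = 0 :=
    Finset.sum_eq_zero fun l _ => Finset.sum_eq_zero fun k _ => hB l k
  simp only [Finset.sum_add_distrib] at hsum
  rw [Finset.sum_comm (f := fun l k => matDeriv k (Q l b) x k l),
    Finset.sum_comm (f := fun l k =>
      (connection g k x * Q l b x + Q l b x * (connection g k x)ᵀ) k l), hd1, hd2, hc, hc'] at hsum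
  rw [Finset.sum_add_distrib]
  have hΓ : ∑ l, ∑ s, christoffel g l l s x * ((g x)⁻¹ * ricciMatrix g x) s b =
      ∑ l, ∑ s, connection g l x l s * ((g x)⁻¹ * ricciMatrix g x) s b := rfl
  rw [hΓ]
  linarith

/-- The contracted second Bianchi identity: the divergence of the Einstein tensor vanishes. -/
theorem contracted_bianchi_einstein (hg : IsMetricOn g U) (hx : x ∈ U) (b : Fin n) :
    ∑ l, (partialDeriv l (fun y => ((g y)⁻¹ * einsteinMatrix g y) l b) x
        + ∑ s, christoffel g l l s x * ((g x)⁻¹ * einsteinMatrix g x) s b) =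
      (connection g b x * ((g x)⁻¹ * einsteinMatrix g x)).trace := by
  have hR := (hg.contDiffAt_scalarCurvature hx).differentiableAt one_ne_zero
  have hd : ∀ l, partialDeriv l (fun y => ((g y)⁻¹ * einsteinMatrix g y) l b) x =
      partialDeriv l (fun y => ((g y)⁻¹ * ricciMatrix g y) l b) x
        - 1 / 2 * (partialDeriv l (scalarCurvature g) x * (1 : Matrix (Fin n) (Fin n) ℝ) l b) := by
    intro l
    have h : (fun y => ((g y)⁻¹ * einsteinMatrix g y) l b) =ᶠ[𝓝 x] fun y =>
        ((g y)⁻¹ * ricciMatrix g y) l b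
          - scalarCurvature g y * (1 / 2 * (1 : Matrix (Fin n) (Fin n) ℝ) l b) := by
      filter_upwards [hg.eventually hx] with y hy
      rw [hg.inv_mul_einsteinMatrix hy, Matrix.sub_apply, Matrix.smul_apply, smul_eq_mul]
      ring
    rw [partialDeriv_congr h, partialDeriv_sub
      ((hg.contDiffAt_inv_mul_ricciMatrix hx).differentiableAt l b)
      (hR.fun_mul (differentiableAt_const _)), partialDeriv_mul hR (differentiableAt_const _),
      partialDeriv_const]
    ring
  have hΓ : ∀ l s, christoffel g l l s x * ((g x)⁻¹ * einsteinMatrix g x) s b =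
      christoffel g l l s x * ((g x)⁻¹ * ricciMatrix g x) s b
        - 1 / 2 * scalarCurvature g x
          * (christoffel g l l s x * (1 : Matrix (Fin n) (Fin n) ℝ) s b) := by
    intro l s
    rw [hg.inv_mul_einsteinMatrix hx, Matrix.sub_apply, Matrix.smul_apply, smul_eq_mul]
    ring
  have h := hg.contracted_bianchi_ricci hx b
  have h1 : ∑ l, partialDeriv l (scalarCurvature g) x * (1 : Matrix (Fin n) (Fin n) ℝ) l b =
      partialDeriv b (scalarCurvature g) x := by
    simp [Matrix.one_apply]
  -- The connection terms of the `δ^l_b` part are `Γ^l_{lb}` on the left and `tr A_b` on the right;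
  -- torsion-freeness makes them equal, so only the derivative of `R` remains.
  have h2 : ∑ l, ∑ s, christoffel g l l s x * (1 : Matrix (Fin n) (Fin n) ℝ) s b =
      (connection g b x).trace := by
    simp only [Matrix.one_apply, mul_ite, mul_one, mul_zero, Finset.sum_ite_eq',
      Finset.mem_univ, if_true, Matrix.trace, Matrix.diag]
    exact Finset.sum_congr rfl fun l _ => hg.christoffel_symm hx l l b
  rw [Finset.sum_add_distrib] at h
  simp only [hd, hΓ, Finset.sum_add_distrib, Finset.sum_sub_distrib, ← Finset.mul_sum, h1, h2]
  rw [hg.inv_mul_einsteinMatrix hx, Matrix.mul_sub, Matrix.trace_sub, Matrix.mul_smul,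
    Matrix.trace_smul, Matrix.mul_one, smul_eq_mul]
  linarith

/-! ### Divergences along coordinate vector fields. -/

/-- Contraction of the connection with a symmetric tensor. -/
theorem trace_connection_mul_inv_mul (hg : IsMetricOn g U) (hx : x ∈ U) (b : Fin n)
    {T : Matrix (Fin n) (Fin n) ℝ} (hT : Tᵀ = T) :
    (connection g b x * ((g x)⁻¹ * T)).trace =
      1 / 2 * ((g x)⁻¹ * matDeriv b g x * (g x)⁻¹ * T).trace := by
  -- By metric compatibility `g⁻¹ (∂_b g) g⁻¹ T` splits into two terms, and transposing one under
  -- the trace, with `T` symmetric, gives the other.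
  have h1 : (g x)⁻¹ * matDeriv b g x * (g x)⁻¹ * T =
      connection g b x * ((g x)⁻¹ * T) + (g x)⁻¹ * (connection g b x)ᵀ * T := by
    have h := hg.matDeriv_inv hx b
    rw [hg.matDeriv_inv_eq_neg_mul hx, neg_inj] at h
    rw [h, Matrix.add_mul, Matrix.mul_assoc]
  have h2 : ((g x)⁻¹ * (connection g b x)ᵀ * T).trace =
      (connection g b x * ((g x)⁻¹ * T)).trace := by
    rw [← Matrix.trace_transpose, Matrix.transpose_mul, Matrix.transpose_mul, hT,
      hg.inv_symm hx, Matrix.transpose_transpose, ← Matrix.mul_assoc, Matrix.trace_mul_cycle,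
      Matrix.trace_mul_cycle, Matrix.mul_assoc]
  rw [h1, Matrix.trace_add, h2]
  ring

theorem trace_connection (hg : IsMetricOn g U) (hx : x ∈ U) (b : Fin n) :
    (connection g b x).trace = 1 / 2 * ((g x)⁻¹ * matDeriv b g x).trace := by
  have h := hg.trace_connection_mul_inv_mul hx b (hg.symm x hx)
  rwa [Matrix.nonsing_inv_mul _ (hg.isUnit_det hx), Matrix.mul_one,
    Matrix.nonsing_inv_mul_cancel_right _ _ (hg.isUnit_det hx)] at h

theorem einsteinUp_eq (hg : IsMetricOn g U) (hx : x ∈ U) (μ ν : Fin n) :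
    einsteinUp g μ ν x = ((g x)⁻¹ * einsteinMatrix g x * (g x)⁻¹) μ ν := by
  simp only [einsteinUp, Matrix.mul_apply, Finset.sum_mul]
  rw [Finset.sum_comm]
  refine Finset.sum_congr rfl fun β _ => Finset.sum_congr rfl fun α _ => ?_
  rw [← congrFun (congrFun (hg.inv_symm hx) β) ν]
  simp only [Matrix.transpose_apply, einsteinMatrix, Matrix.of_apply]
  ring

/-- The current of a coordinate vector field is a column of the mixed Einstein tensor. -/
theorem einsteinCurrent_single (hg : IsMetricOn g U) (hx : x ∈ U) (b μ : Fin n) :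
    einsteinCurrent g (fun _ => Pi.single b 1) x μ = ((g x)⁻¹ * einsteinMatrix g x) μ b := by
  have h : einsteinCurrent g (fun _ => Pi.single b 1) x μ =
      ((g x)⁻¹ * einsteinMatrix g x * (g x)⁻¹ * g x) μ b := by
    rw [Matrix.mul_apply]
    refine Finset.sum_congr rfl fun ν _ => ?_
    rw [hg.einsteinUp_eq hx]
    simp [lowerIndex, Pi.single_apply]
  rw [h, Matrix.nonsing_inv_mul_cancel_right _ _ (hg.isUnit_det hx)]

theorem differentiableAt_einsteinCurrent_single (hg : IsMetricOn g U) (hx : x ∈ U) (b : Fin n) :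
    DifferentiableAt ℝ (einsteinCurrent g fun _ => Pi.single b 1) x := by
  rw [differentiableAt_pi]
  intro μ
  refine ((hg.contDiffAt_inv_mul_einsteinMatrix hx).differentiableAt μ b).congr_of_eventuallyEq ?_
  exact (hg.eventually hx).mono fun y hy => hg.einsteinCurrent_single hy b μ

/-- The divergence of the current of a coordinate vector field. -/
theorem divergence_einsteinCurrent_single (hg : IsMetricOn g U) (hx : x ∈ U) (b : Fin n) :
    divergence g (einsteinCurrent g fun _ => Pi.single b 1) x =
      1 / 2 * ((g x)⁻¹ * matDeriv b g x * (g x)⁻¹ * einsteinMatrix g x).trace := by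
  rw [← hg.trace_connection_mul_inv_mul hx b (hg.einsteinMatrix_transpose hx),
    ← hg.contracted_bianchi_einstein hx b]
  refine Finset.sum_congr rfl fun l _ => ?_
  simp only [covDeriv, hg.einsteinCurrent_single hx]
  congr 1
  exact partialDeriv_congr ((hg.eventually hx).mono fun y hy =>
    hg.einsteinCurrent_single hy b l) l

/-- The diagonal Ricci component along a coordinate whose coordinate lines are affine geodesics. -/
theorem ricci_diag (hg : IsMetricOn g U) (hx : x ∈ U) {b : Fin n}
    (hb : ∀ y ∈ U, ∀ l, christoffel g l b b y = 0) :
    ricci g b b x = -partialDeriv b (fun y => (connection g b y).trace) x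
      - (connection g b x * connection g b x).trace := by
  have hd : ∀ l, partialDeriv l (christoffel g l b b) x = 0 := fun l => by
    rw [partialDeriv_congr (g := fun _ => 0) ((hg.eventually hx).mono fun y hy => hb y hy l),
      partialDeriv_const]
  -- In `R_bb` every term containing `Γ^l_{bb}` drops out; the surviving derivative terms add up to
  -- the derivative of `tr A_b`.
  have ht : partialDeriv b (fun y => (connection g b y).trace) x =
      ∑ l, partialDeriv b (christoffel g l l b) x := by
    have h : ∀ l, partialDeriv b (christoffel g l l b) x =
        partialDeriv b (fun y => connection g b y l l) x := fun l =>
      partialDeriv_congr ((hg.eventually hx).mono fun y hy => hg.christoffel_symm hy l l b) b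
    simp only [h]
    exact partialDeriv_sum _ (fun l _ => MatContDiffAt.differentiableAt (k := 1)
      (hg.contDiffAt_connection hx b) l l) b
  rw [ht]
  simp only [ricci, riemann, hd, hb x hx, mul_zero, Finset.sum_add_distrib,
    Finset.sum_neg_distrib, Matrix.trace, Matrix.diag, Matrix.mul_apply, sub_eq_add_neg,
    zero_add]
  congr 2
  exact Finset.sum_congr rfl fun l _ => Finset.sum_congr rfl fun s _ => by
    rw [hg.christoffel_symm hx s l b]; rfl

theorem divergence_single (hg : IsMetricOn g U) (hx : x ∈ U) (b : Fin n) :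
    divergence g (fun _ => Pi.single b 1) x = 1 / 2 * ((g x)⁻¹ * matDeriv b g x).trace := by
  rw [← hg.trace_connection hx b]
  refine Finset.sum_congr rfl fun l _ => ?_
  simp only [covDeriv, partialDeriv_const, zero_add, Pi.single_apply, mul_ite, mul_one, mul_zero,
    Finset.sum_ite_eq', Finset.mem_univ, if_true]
  exact hg.christoffel_symm hx l l b

end IsMetricOn

end ChartGeometry

/-! ### Smoothness and null decomposition of the Kerr-Vaidya-de Sitter metric. -/

namespace KerrVaidyaDeSitter

open ChartGeometry Matrix Filter Topology

variable {Λ a : ℝ} {M : ℝ → ℝ} {x : Fin 4 → ℝ}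

theorem isOpen_domain : IsOpen domain :=
  (isOpen_lt continuous_const (continuous_apply 1)).inter
    ((isOpen_lt continuous_const (continuous_apply 2)).inter
      (isOpen_lt (continuous_apply 2) continuous_const))

theorem rhoSq_pos (hx : x ∈ domain) : 0 < rhoSq a x := by
  have := hx.1
  unfold rhoSq
  positivity

theorem Theta_pos : 0 < Theta Λ a x := by
  unfold Theta
  positivity

theorem Zc_pos : 0 < Zc Λ a := by
  unfold Zc
  positivity

theorem sin_pos_of_mem (hx : x ∈ domain) : 0 < Real.sin (x 2) :=
  Real.sin_pos_of_pos_of_lt_pi hx.2.1 hx.2.2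

/-- The coefficient `Δ_Λ / (ρ² Z²)` of the square of the ingoing null covector. -/
noncomputable def nullCoeff (Λ a : ℝ) (M : ℝ → ℝ) (x : Fin 4 → ℝ) : ℝ :=
  DeltaL Λ a M x * ((rhoSq a x)⁻¹ * (Zc Λ a ^ 2)⁻¹)

/-- The coefficient `Θ sin² θ / (ρ² Z²)` of the square of the azimuthal covector. -/
noncomputable def azimuthCoeff (Λ a : ℝ) (x : Fin 4 → ℝ) : ℝ :=
  Theta Λ a x * Real.sin (x 2) ^ 2 * (Zc Λ a ^ 2)⁻¹ * (rhoSq a x)⁻¹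

theorem contDiffAt_rhoSq {k : WithTop ℕ∞} : ContDiffAt ℝ k (rhoSq a) x := by
  unfold rhoSq
  fun_prop

theorem contDiffAt_Theta {k : WithTop ℕ∞} : ContDiffAt ℝ k (Theta Λ a) x := by
  unfold Theta
  fun_prop

theorem contDiffAt_Gam {k : WithTop ℕ∞} : ContDiffAt ℝ k (Gam a) x := by
  unfold Gam
  fun_prop

theorem contDiffAt_sin_sq {k : WithTop ℕ∞} :
    ContDiffAt ℝ k (fun y : Fin 4 → ℝ => Real.sin (y 2) ^ 2) x := by
  fun_prop

theorem contDiffAt_nullCoeff (hM : ContDiff ℝ 3 M) (hx : x ∈ domain) :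
    ContDiffAt ℝ 3 (nullCoeff Λ a M) x := by
  have hM' : ContDiffAt ℝ 3 (fun y : Fin 4 → ℝ => M (y 0)) x :=
    (hM.comp (contDiff_apply ℝ ℝ 0)).contDiffAt
  have hD : ContDiffAt ℝ 3 (DeltaL Λ a M) x := by
    unfold DeltaL Gam
    fun_prop
  exact hD.mul ((contDiffAt_rhoSq.inv (rhoSq_pos hx).ne').mul contDiffAt_const)

theorem contDiffAt_azimuthCoeff (hx : x ∈ domain) {k : WithTop ℕ∞} :
    ContDiffAt ℝ k (azimuthCoeff Λ a) x :=
  ((contDiffAt_Theta.mul contDiffAt_sin_sq).mul contDiffAt_const).mul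
    (contDiffAt_rhoSq.inv (rhoSq_pos hx).ne')

/-- Here and in the next two lemmas the components are expanded in `α` and `β`, which isolates the
dependence on the mass function in `α`. -/
theorem gvv_eq : gvv Λ a M = fun y => -nullCoeff Λ a M y + a ^ 2 * azimuthCoeff Λ a y := by
  funext y
  simp only [gvv, nullCoeff, azimuthCoeff, div_eq_mul_inv, mul_inv]
  ring

theorem gvpsi_eq : gvpsi Λ a M = fun y =>
    a * Real.sin (y 2) ^ 2 * nullCoeff Λ a M y + -a * (Gam a y * azimuthCoeff Λ a y) := by
  funext y
  simp only [gvpsi, nullCoeff, azimuthCoeff, div_eq_mul_inv, mul_inv]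
  ring

theorem gpsipsi_eq : gpsipsi Λ a M = fun y =>
    -(a * Real.sin (y 2) ^ 2) ^ 2 * nullCoeff Λ a M y
      + Gam a y * (Gam a y * azimuthCoeff Λ a y) := by
  funext y
  simp only [gpsipsi, nullCoeff, azimuthCoeff, div_eq_mul_inv, mul_inv]
  ring

theorem isMetricOn_metric (hM : ContDiff ℝ 3 M) : IsMetricOn (metric Λ a M) domain where
  isOpen := isOpen_domain
  contDiffAt := by
    intro x hx
    have hα := contDiffAt_nullCoeff (Λ := Λ) (a := a) hM hx
    have hβ : ContDiffAt ℝ 3 (azimuthCoeff Λ a) x := contDiffAt_azimuthCoeff hx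
    have hs : ContDiffAt ℝ 3 (fun y : Fin 4 → ℝ => Real.sin (y 2) ^ 2) x := contDiffAt_sin_sq
    have hG : ContDiffAt ℝ 3 (Gam a) x := contDiffAt_Gam
    have hvv : ContDiffAt ℝ 3 (gvv Λ a M) x := by
      rw [gvv_eq]
      exact hα.neg.add (contDiffAt_const.mul hβ)
    have hvp : ContDiffAt ℝ 3 (gvpsi Λ a M) x := by
      rw [gvpsi_eq]
      exact ((contDiffAt_const.mul hs).mul hα).add (contDiffAt_const.mul (hG.mul hβ))
    have hpp : ContDiffAt ℝ 3 (gpsipsi Λ a M) x := by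
      rw [gpsipsi_eq]
      exact (((contDiffAt_const.mul hs).pow 2).neg.mul hα).add (hG.mul (hG.mul hβ))
    have hrp : ContDiffAt ℝ 3 (grpsi Λ a) x := by
      unfold grpsi
      fun_prop
    have htt : ContDiffAt ℝ 3 (fun y => rhoSq a y / Theta Λ a y) x :=
      contDiffAt_rhoSq.div contDiffAt_Theta Theta_pos.ne'
    have hc : ∀ c : ℝ, ContDiffAt ℝ 3 (fun _ : Fin 4 → ℝ => c) x := fun c => contDiffAt_const
    intro i j
    fin_cases i <;> fin_cases j <;>
      first | exact hvv | exact hvp | exact hpp | exact hrp | exact htt | exact hc _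
  symm := by
    intro x _
    ext i j
    fin_cases i <;> fin_cases j <;> rfl
  det_ne_zero := by
    intro x hx
    have h1 := rhoSq_pos (a := a) hx
    have h2 := sin_pos_of_mem hx
    have h3 := Zc_pos (Λ := Λ) (a := a)
    rw [det_metric Λ a M x hx]
    exact neg_ne_zero.mpr (by positivity)

/-! ### The null covector and the time derivative of the metric. -/

/-- The components of the null covector `dv - a sin² θ dψ`. -/
noncomputable def nullCovector (a : ℝ) (x : Fin 4 → ℝ) : Fin 4 → ℝ :=
  ![1, 0, 0, -(a * Real.sin (x 2) ^ 2)]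

theorem metric_mulVec_single :
    metric Λ a M x *ᵥ Pi.single 1 1 = (Zc Λ a)⁻¹ • nullCovector a x := by
  ext i
  fin_cases i <;> simp [metric, nullCovector, grpsi]
  ring

/-- Lowering the index of `∂_r` gives `k / Z`; inverting this avoids computing the inverse metric.
-/
theorem inv_metric_mulVec_nullCovector (hM : ContDiff ℝ 3 M) (hx : x ∈ domain) :
    (metric Λ a M x)⁻¹ *ᵥ nullCovector a x = Zc Λ a • Pi.single 1 1 := by
  have h : nullCovector a x = Zc Λ a • (metric Λ a M x *ᵥ Pi.single 1 1) := by
    rw [metric_mulVec_single, smul_smul, mul_inv_cancel₀ Zc_pos.ne', one_smul]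
  rw [h, Matrix.mulVec_smul, Matrix.mulVec_mulVec,
    Matrix.nonsing_inv_mul _ ((isMetricOn_metric hM).isUnit_det hx), Matrix.one_mulVec]

theorem partialDeriv_zero_azimuthCoeff : partialDeriv 0 (azimuthCoeff Λ a) x = 0 := by
  simp [partialDeriv, azimuthCoeff, Theta, rhoSq]

/-- Only the coefficient `α` of `-k²` depends on `v`, so the derivative has rank at most one. -/
theorem matDeriv_zero_metric (hM : ContDiff ℝ 3 M) (hx : x ∈ domain) :
    matDeriv 0 (metric Λ a M) x = -partialDeriv 0 (nullCoeff Λ a M) x •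
      vecMulVec (nullCovector a x) (nullCovector a x) := by
  have hα := (contDiffAt_nullCoeff (Λ := Λ) (a := a) hM hx).differentiableAt (by simp)
  have hβ : DifferentiableAt ℝ (azimuthCoeff Λ a) x :=
    (contDiffAt_azimuthCoeff hx (k := 1)).differentiableAt (by simp)
  have hs : DifferentiableAt ℝ (fun y : Fin 4 → ℝ => Real.sin (y 2) ^ 2) x := by fun_prop
  have hG : DifferentiableAt ℝ (Gam a) x := by
    unfold Gam
    fun_prop
  have hG0 : partialDeriv 0 (Gam a) x = 0 := by simp [partialDeriv, Gam]
  have hs1 : partialDeriv 0 (fun y : Fin 4 → ℝ => a * Real.sin (y 2) ^ 2) x = 0 := by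
    simp [partialDeriv]
  have hs2 : partialDeriv 0 (fun y : Fin 4 → ℝ => -(a * Real.sin (y 2) ^ 2) ^ 2) x = 0 := by
    simp [partialDeriv]
  have hβ0 := partialDeriv_zero_azimuthCoeff (Λ := Λ) (a := a) (x := x)
  have hvv : partialDeriv 0 (gvv Λ a M) x = -partialDeriv 0 (nullCoeff Λ a M) x := by
    rw [gvv_eq, partialDeriv_add hα.fun_neg (hβ.const_mul _), partialDeriv_neg,
      partialDeriv_mul (differentiableAt_const _) hβ, hβ0, partialDeriv_const]
    ring
  have hvp : partialDeriv 0 (gvpsi Λ a M) x =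
      a * Real.sin (x 2) ^ 2 * partialDeriv 0 (nullCoeff Λ a M) x := by
    rw [gvpsi_eq, partialDeriv_add ((hs.const_mul a).fun_mul hα) ((hG.fun_mul hβ).const_mul _),
      partialDeriv_mul (hs.const_mul a) hα,
      partialDeriv_mul (differentiableAt_const _) (hG.fun_mul hβ), partialDeriv_mul hG hβ,
      hβ0, hG0, hs1, partialDeriv_const]
    ring
  have hpp : partialDeriv 0 (gpsipsi Λ a M) x =
      -(a * Real.sin (x 2) ^ 2) ^ 2 * partialDeriv 0 (nullCoeff Λ a M) x := by
    rw [gpsipsi_eq, partialDeriv_add (((hs.const_mul a).fun_pow 2).fun_neg.fun_mul hα)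
      (hG.fun_mul (hG.fun_mul hβ)), partialDeriv_mul ((hs.const_mul a).fun_pow 2).fun_neg hα,
      partialDeriv_mul hG (hG.fun_mul hβ), partialDeriv_mul hG hβ, hβ0, hG0, hs2]
    ring
  have hrp : partialDeriv 0 (grpsi Λ a) x = 0 := by simp [partialDeriv, grpsi]
  have htt : partialDeriv 0 (fun y => rhoSq a y / Theta Λ a y) x = 0 := by
    simp [partialDeriv, rhoSq, Theta]
  ext i j
  rw [matDeriv_apply]
  fin_cases i <;> fin_cases j <;>
    simp [metric, nullCovector, hvv, hvp, hpp, hrp, htt, partialDeriv_const]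
  all_goals ring

/-! ### The radial connection and the vanishing of `R_rr`. -/

/-- The rows are the components of the covectors `dv - a sin² θ dψ`, `dr`, `dθ` and
`a dv - Γ dψ`. -/
noncomputable def coframe (a : ℝ) (x : Fin 4 → ℝ) : Matrix (Fin 4) (Fin 4) ℝ :=
  !![1, 0, 0, -(a * Real.sin (x 2) ^ 2);
     0, 1, 0, 0;
     0, 0, 1, 0;
     a, 0, 0, -Gam a x]

/-- The components of the metric in `coframe`. -/
noncomputable def frameMetric (Λ a : ℝ) (M : ℝ → ℝ) (x : Fin 4 → ℝ) :
    Matrix (Fin 4) (Fin 4) ℝ :=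
  !![-nullCoeff Λ a M x, (Zc Λ a)⁻¹, 0, 0;
     (Zc Λ a)⁻¹, 0, 0, 0;
     0, 0, rhoSq a x / Theta Λ a x, 0;
     0, 0, 0, azimuthCoeff Λ a x]

/-- The radial connection matrix `Γ^l_{rκ}` in `coframe`. -/
noncomputable def frameConnection (Λ a : ℝ) (M : ℝ → ℝ) (x : Fin 4 → ℝ) :
    Matrix (Fin 4) (Fin 4) ℝ :=
  !![0, 0, 0, 0;
     -(1 / 2 * Zc Λ a * partialDeriv 1 (nullCoeff Λ a M) x), 0,
       -(a ^ 2 * Real.sin (x 2) * Real.cos (x 2) / rhoSq a x),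
       -(Zc Λ a * x 1 * a * azimuthCoeff Λ a x / rhoSq a x);
     a ^ 2 * Real.sin (x 2) * Real.cos (x 2) * Theta Λ a x / (Zc Λ a * rhoSq a x ^ 2), 0,
       x 1 / rhoSq a x,
       -(a * Real.sin (x 2) * Real.cos (x 2) * Theta Λ a x / (Zc Λ a * rhoSq a x ^ 2));
     -(x 1 * a / rhoSq a x), 0,
       a * Real.cos (x 2) * Zc Λ a / (Theta Λ a x * Real.sin (x 2)),
       x 1 / rhoSq a x]

theorem Gam_eq : Gam a x = rhoSq a x + a ^ 2 * Real.sin (x 2) ^ 2 := by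
  unfold Gam rhoSq
  rw [Real.cos_sq' (x 2)]
  ring

theorem det_coframe : (coframe a x).det = -rhoSq a x := by
  rw [coframe, Matrix.det_succ_row_zero]
  simp [Fin.sum_univ_succ, Matrix.det_fin_three, Fin.succAbove, Gam_eq]
  ring

theorem isUnit_det_coframe (hx : x ∈ domain) : IsUnit (coframe a x).det := by
  rw [det_coframe]
  exact (neg_ne_zero.mpr (rhoSq_pos hx).ne').isUnit

theorem metric_eq_frame :
    metric Λ a M x = (coframe a x)ᵀ * frameMetric Λ a M x * coframe a x := by
  ext i j
  fin_cases i <;> fin_cases j <;>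
    simp [metric, coframe, frameMetric, Matrix.mul_apply, Fin.sum_univ_four, gvv_eq, gvpsi_eq,
      gpsipsi_eq, grpsi]
  all_goals ring

theorem partialDeriv_one_rhoSq : partialDeriv 1 (rhoSq a) x = 2 * x 1 := by
  simp [partialDeriv, rhoSq]

theorem partialDeriv_one_azimuthCoeff (hx : x ∈ domain) :
    partialDeriv 1 (azimuthCoeff Λ a) x = -(2 * x 1 * azimuthCoeff Λ a x / rhoSq a x) := by
  have hρ : DifferentiableAt ℝ (rhoSq a) x :=
    (contDiffAt_rhoSq (k := 1)).differentiableAt (by simp)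
  have hc : DifferentiableAt ℝ
      (fun y : Fin 4 → ℝ => Theta Λ a y * Real.sin (y 2) ^ 2 * (Zc Λ a ^ 2)⁻¹) x := by
    unfold Theta
    fun_prop
  have hc0 : partialDeriv 1
      (fun y : Fin 4 → ℝ => Theta Λ a y * Real.sin (y 2) ^ 2 * (Zc Λ a ^ 2)⁻¹) x = 0 := by
    simp [partialDeriv, Theta]
  have h0 := (rhoSq_pos (a := a) hx).ne'
  have h : partialDeriv 1 (azimuthCoeff Λ a) x = _ :=
    partialDeriv_mul hc (hρ.fun_inv h0) 1
  rw [h, hc0, partialDeriv_inv hρ h0, partialDeriv_one_rhoSq, azimuthCoeff]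
  field_simp
  ring

/-- Besides `∂_r g`, the symbols `Γ_{σ r ν}` involve only derivatives of the components `g_{rν}`,
which are constant or functions of `θ`. Hence neither `M'` nor any `θ`-derivative of `α` and `β`
occurs. -/
theorem lowerConnection_one_metric (hM : ContDiff ℝ 3 M) (hx : x ∈ domain) :
    lowerConnection (metric Λ a M) 1 x =
      (coframe a x)ᵀ * (frameMetric Λ a M x * frameConnection Λ a M x) * coframe a x := by
  have hα := (contDiffAt_nullCoeff (Λ := Λ) (a := a) hM hx).differentiableAt (by simp)
  have hβ : DifferentiableAt ℝ (azimuthCoeff Λ a) x :=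
    (contDiffAt_azimuthCoeff hx (k := 1)).differentiableAt (by simp)
  have hs : DifferentiableAt ℝ (fun y : Fin 4 → ℝ => Real.sin (y 2) ^ 2) x := by fun_prop
  have hG : DifferentiableAt ℝ (Gam a) x := by
    unfold Gam
    fun_prop
  have hG1 : partialDeriv 1 (Gam a) x = 2 * x 1 := by simp [partialDeriv, Gam]
  have hs1 : partialDeriv 1 (fun y : Fin 4 → ℝ => a * Real.sin (y 2) ^ 2) x = 0 := by
    simp [partialDeriv]
  have hs2 : partialDeriv 1 (fun y : Fin 4 → ℝ => -(a * Real.sin (y 2) ^ 2) ^ 2) x = 0 := by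
    simp [partialDeriv]
  have hβ1 := partialDeriv_one_azimuthCoeff (Λ := Λ) (a := a) hx
  have hvv : partialDeriv 1 (gvv Λ a M) x = -partialDeriv 1 (nullCoeff Λ a M) x
      - a ^ 2 * (2 * x 1 * azimuthCoeff Λ a x / rhoSq a x) := by
    rw [gvv_eq, partialDeriv_add hα.fun_neg (hβ.const_mul _), partialDeriv_neg,
      partialDeriv_mul (differentiableAt_const _) hβ, hβ1, partialDeriv_const]
    ring
  have hvp : partialDeriv 1 (gvpsi Λ a M) x =
      a * Real.sin (x 2) ^ 2 * partialDeriv 1 (nullCoeff Λ a M) x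
        - a * (2 * x 1 * azimuthCoeff Λ a x
          - Gam a x * (2 * x 1 * azimuthCoeff Λ a x / rhoSq a x)) := by
    rw [gvpsi_eq, partialDeriv_add ((hs.const_mul a).fun_mul hα) ((hG.fun_mul hβ).const_mul _),
      partialDeriv_mul (hs.const_mul a) hα,
      partialDeriv_mul (differentiableAt_const _) (hG.fun_mul hβ), partialDeriv_mul hG hβ,
      hβ1, hG1, hs1, partialDeriv_const]
    ring
  have hpp : partialDeriv 1 (gpsipsi Λ a M) x =
      -(a * Real.sin (x 2) ^ 2) ^ 2 * partialDeriv 1 (nullCoeff Λ a M) x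
        + Gam a x * (4 * x 1 * azimuthCoeff Λ a x
          - Gam a x * (2 * x 1 * azimuthCoeff Λ a x / rhoSq a x)) := by
    rw [gpsipsi_eq, partialDeriv_add (((hs.const_mul a).fun_pow 2).fun_neg.fun_mul hα)
      (hG.fun_mul (hG.fun_mul hβ)), partialDeriv_mul ((hs.const_mul a).fun_pow 2).fun_neg hα,
      partialDeriv_mul hG (hG.fun_mul hβ), partialDeriv_mul hG hβ, hβ1, hG1, hs2]
    ring
  have htt : partialDeriv 1 (fun y => rhoSq a y / Theta Λ a y) x = 2 * x 1 / Theta Λ a x := by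
    simp [partialDeriv, rhoSq, Theta]
  have hrp0 : partialDeriv 0 (grpsi Λ a) x = 0 := by simp [partialDeriv, grpsi]
  have hrp1 : partialDeriv 1 (grpsi Λ a) x = 0 := by simp [partialDeriv, grpsi]
  have hrp2 : partialDeriv 2 (grpsi Λ a) x =
      -(2 * a * Real.sin (x 2) * Real.cos (x 2) / Zc Λ a) := by
    simp [partialDeriv, grpsi]
    ring
  have hrp3 : partialDeriv 3 (grpsi Λ a) x = 0 := by simp [partialDeriv, grpsi]
  have h1 := (rhoSq_pos (a := a) hx).ne'
  have h2 := (sin_pos_of_mem hx).ne'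
  have h3 := (Zc_pos (Λ := Λ) (a := a)).ne'
  have h4 := (Theta_pos (Λ := Λ) (a := a) (x := x)).ne'
  -- In the entrywise check `azimuthCoeff` is treated as an atom, except in this product, where its
  -- explicit value is needed to cancel `Θ` and `sin θ`.
  have hm : azimuthCoeff Λ a x * (a * Real.cos (x 2) * Zc Λ a / (Theta Λ a x * Real.sin (x 2))) =
      a * Real.sin (x 2) * Real.cos (x 2) / (Zc Λ a * rhoSq a x) := by
    unfold azimuthCoeff
    field_simp
  ext i j
  fin_cases i <;> fin_cases j <;>
    simp [lowerConnection, metric, coframe, frameMetric, frameConnection, Matrix.mul_apply,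
      Fin.sum_univ_four, hvv, hvp, hpp, hrp0, hrp1, hrp2, hrp3, htt, partialDeriv_const,
      Gam_eq, hm] <;>
    field_simp <;> ring

/-- This is pointwise conjugation, with no derivative of the coframe added, so traces of powers are
those of `frameConnection`. -/
theorem connection_one_metric (hM : ContDiff ℝ 3 M) (hx : x ∈ domain) :
    connection (metric Λ a M) 1 x =
      (coframe a x)⁻¹ * frameConnection Λ a M x * coframe a x := by
  have hE := isUnit_det_coframe (a := a) hx
  have h : metric Λ a M x * ((coframe a x)⁻¹ * frameConnection Λ a M x * coframe a x) =
      lowerConnection (metric Λ a M) 1 x := by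
    rw [lowerConnection_one_metric hM hx, metric_eq_frame]
    simp only [Matrix.mul_assoc, Matrix.mul_nonsing_inv_cancel_left _ _ hE]
  rw [connection_eq, ← h,
    Matrix.nonsing_inv_mul_cancel_left _ _ ((isMetricOn_metric hM).isUnit_det hx)]

theorem trace_connection_one_metric (hM : ContDiff ℝ 3 M) (hx : x ∈ domain) :
    (connection (metric Λ a M) 1 x).trace = 2 * x 1 * (rhoSq a x)⁻¹ := by
  rw [connection_one_metric hM hx, Matrix.mul_assoc, Matrix.trace_mul_comm,
    Matrix.mul_nonsing_inv_cancel_right _ _ (isUnit_det_coframe hx)]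
  simp [Matrix.trace, Fin.sum_univ_four, frameConnection]
  ring

/-- Only the transverse `2 × 2` block contributes. Its eigenvalues are `λ = 1 / (r ± i a cos θ)`,
that is expansion and twist without shear. Since `∂_r λ = -λ²`, this trace cancels the derivative of
the first one in `R_rr`. -/
theorem trace_connection_one_metric_sq (hM : ContDiff ℝ 3 M) (hx : x ∈ domain) :
    (connection (metric Λ a M) 1 x * connection (metric Λ a M) 1 x).trace =
      2 * (x 1 ^ 2 - a ^ 2 * Real.cos (x 2) ^ 2) / rhoSq a x ^ 2 := by
  have hE := isUnit_det_coframe (a := a) hx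
  have h : connection (metric Λ a M) 1 x * connection (metric Λ a M) 1 x =
      (coframe a x)⁻¹ * (frameConnection Λ a M x * frameConnection Λ a M x * coframe a x) := by
    rw [connection_one_metric hM hx]
    simp only [Matrix.mul_assoc, Matrix.mul_nonsing_inv_cancel_left _ _ hE]
  rw [h, Matrix.trace_mul_comm, Matrix.mul_nonsing_inv_cancel_right _ _ hE]
  have h1 := (rhoSq_pos (a := a) hx).ne'
  have h2 := (sin_pos_of_mem hx).ne'
  have h3 := (Zc_pos (Λ := Λ) (a := a)).ne'
  have h4 := (Theta_pos (Λ := Λ) (a := a) (x := x)).ne'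
  simp [Matrix.trace, Fin.sum_univ_four, frameConnection]
  field_simp
  ring

/-- The `r` columns of both `frameConnection` and the coframe give `∇_r ∂_r = 0`, the hypothesis of
`IsMetricOn.ricci_diag`. -/
theorem christoffel_one_one_metric (hM : ContDiff ℝ 3 M) (hx : x ∈ domain) (l : Fin 4) :
    christoffel (metric Λ a M) l 1 1 x = 0 := by
  have h : connection (metric Λ a M) 1 x l 1 = 0 := by
    rw [connection_one_metric hM hx, Matrix.mul_assoc]
    simp [Matrix.mul_apply, Fin.sum_univ_four, frameConnection, coframe]
  exact h

/-- The Ricci tensor vanishes on the null vector field `∂/∂r`. -/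
theorem ricci_one_one_metric (hM : ContDiff ℝ 3 M) (hx : x ∈ domain) :
    ricci (metric Λ a M) 1 1 x = 0 := by
  have hg := isMetricOn_metric (Λ := Λ) (a := a) hM
  have hρ : DifferentiableAt ℝ (rhoSq a) x :=
    (contDiffAt_rhoSq (k := 1)).differentiableAt (by simp)
  have h0 := (rhoSq_pos (a := a) hx).ne'
  have h1 : partialDeriv 1 (fun y : Fin 4 → ℝ => 2 * y 1) x = 2 := by simp [partialDeriv]
  rw [hg.ricci_diag hx fun y hy l => christoffel_one_one_metric hM hy l,
    trace_connection_one_metric_sq hM hx,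
    partialDeriv_congr ((hg.eventually hx).mono fun y hy => trace_connection_one_metric hM hy),
    partialDeriv_mul (by fun_prop) (hρ.fun_inv h0), h1, partialDeriv_inv hρ h0,
    partialDeriv_one_rhoSq]
  field_simp
  unfold rhoSq
  ring

theorem einstein_one_one_metric (hM : ContDiff ℝ 3 M) (hx : x ∈ domain) :
    einstein (metric Λ a M) 1 1 x = 0 := by
  rw [einstein, ricci_one_one_metric hM hx]
  simp [metric]

/-! ### Divergence of the Kodama field and conservation of its current. -/

theorem inv_metric_mul_vecMulVec (hM : ContDiff ℝ 3 M) (hx : x ∈ domain) :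
    (metric Λ a M x)⁻¹ * vecMulVec (nullCovector a x) (nullCovector a x) =
      Zc Λ a • vecMulVec (Pi.single 1 1) (nullCovector a x) := by
  rw [Matrix.mul_vecMulVec, inv_metric_mulVec_nullCovector hM hx, Matrix.smul_vecMulVec]

/-- The trace is a multiple of `k(∂_r)`, and `k` has no `dr` component. -/
theorem divergence_kodamaField (hM : ContDiff ℝ 3 M) (hx : x ∈ domain) :
    divergence (metric Λ a M) kodamaField x = 0 := by
  refine ((isMetricOn_metric hM).divergence_single hx 0).trans ?_
  rw [matDeriv_zero_metric hM hx, Matrix.mul_smul, inv_metric_mul_vecMulVec hM hx,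
    Matrix.trace_smul, Matrix.trace_smul, Matrix.trace_vecMulVec]
  simp [nullCovector]

/-- Raising both factors of `k ⊗ k` turns the contraction with `G` into a multiple of `Z² G_rr`. -/
theorem divergence_einsteinCurrent_kodamaField (hM : ContDiff ℝ 3 M) (hx : x ∈ domain) :
    divergence (metric Λ a M) (einsteinCurrent (metric Λ a M) kodamaField) x = 0 := by
  have hg := isMetricOn_metric (Λ := Λ) (a := a) hM
  refine (hg.divergence_einsteinCurrent_single hx 0).trans ?_
  have h : nullCovector a x ᵥ* (metric Λ a M x)⁻¹ = Zc Λ a • Pi.single 1 1 := by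
    rw [← Matrix.mulVec_transpose, hg.inv_symm hx, inv_metric_mulVec_nullCovector hM hx]
  have hE : einsteinMatrix (metric Λ a M) x 1 1 = 0 := einstein_one_one_metric hM hx
  rw [matDeriv_zero_metric hM hx, Matrix.mul_smul, inv_metric_mul_vecMulVec hM hx,
    Matrix.smul_mul, Matrix.smul_mul, Matrix.smul_mul, Matrix.smul_mul, Matrix.vecMulVec_mul, h,
    Matrix.vecMulVec_mul, Matrix.trace_smul, Matrix.trace_smul, Matrix.trace_vecMulVec]
  simp [Matrix.smul_vecMul, hE]

/-! ### Tangency, causal character and zeros of `Δ_Λ`. -/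

theorem derivAlong_kodamaField : derivAlong kodamaField (fun y => y 1) x = 0 := by
  simp [derivAlong, kodamaField, Fin.sum_univ_four, partialDeriv]

theorem normSq_kodamaField : normSq (metric Λ a M) kodamaField x =
    (Theta Λ a x * a ^ 2 * Real.sin (x 2) ^ 2 - DeltaL Λ a M x) / (rhoSq a x * Zc Λ a ^ 2) := by
  simp [normSq, lowerIndex, kodamaField, Pi.single_apply, metric, gvv]
  ring

/-- On the slice `v = 0`, `Δ_Λ` is a polynomial in `r` equal to `a² > 0` at `r = 0` and negative for
large `r`, because `-H² r⁴` dominates; the intermediate value theorem applies for any value of the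
mass. -/
theorem exists_DeltaL_eq_zero (hΛ : 0 < Λ) (ha : a ≠ 0) (M : ℝ → ℝ) :
    ∃ x ∈ domain, DeltaL Λ a M x = 0 := by
  have hH : 0 < hubble Λ := Real.sqrt_pos.mpr (by positivity)
  have ha2 : 0 < a ^ 2 := by positivity
  set H := hubble Λ with hHdef
  set m := M 0
  let f : ℝ → ℝ := fun r => (r ^ 2 - 2 * m * r + a ^ 2) - (r ^ 2 + a ^ 2) * r ^ 2 * H ^ 2
  have hf : Continuous f := by fun_prop
  have hpos : 0 < f 0 := by simpa [f] using ha2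
  obtain ⟨R, hR, hneg⟩ : ∃ R, 0 < R ∧ f R < 0 := by
    set C := 1 + 2 * |m| + a ^ 2 with hC
    have hC1 : 1 ≤ C := by have := abs_nonneg m; linarith
    -- `C` is chosen so that `r² - 2 m r + a² ≤ C r²` for `r ≥ 1`; this `R` satisfies `R ≥ 1` and `C
    -- < R H²`, so the quartic term wins.
    refine ⟨1 + C / H ^ 2, by positivity, ?_⟩
    set R := 1 + C / H ^ 2 with hRdef
    have hR1 : 1 ≤ R := by
      have : 0 ≤ C / H ^ 2 := by positivity
      linarith
    have hRH : C < R * H ^ 2 := by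
      rw [hRdef, add_mul, div_mul_cancel₀ _ (by positivity)]
      have : 0 < H ^ 2 := by positivity
      linarith
    have hR2 : R ≤ R ^ 2 := by nlinarith
    have h1 : R ^ 2 - 2 * m * R + a ^ 2 ≤ C * R ^ 2 := by
      have e1 : -(m * R) ≤ |m| * R ^ 2 := by
        calc -(m * R) = -m * R := by ring
          _ ≤ |m| * R := mul_le_mul_of_nonneg_right (neg_le_abs m) (by linarith)
          _ ≤ |m| * R ^ 2 := mul_le_mul_of_nonneg_left hR2 (abs_nonneg m)
      have e2 : a ^ 2 ≤ a ^ 2 * R ^ 2 := le_mul_of_one_le_right ha2.le (by linarith)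
      rw [hC]
      linarith
    have h2 : C * R ^ 2 < (R ^ 2 + a ^ 2) * R ^ 2 * H ^ 2 := by
      have e1 : C < (R ^ 2 + a ^ 2) * H ^ 2 := by
        refine hRH.trans_le (mul_le_mul_of_nonneg_right ?_ (by positivity))
        linarith
      calc C * R ^ 2 < (R ^ 2 + a ^ 2) * H ^ 2 * R ^ 2 :=
            mul_lt_mul_of_pos_right e1 (by positivity)
        _ = (R ^ 2 + a ^ 2) * R ^ 2 * H ^ 2 := by ring
    have h3 : f R = (R ^ 2 - 2 * m * R + a ^ 2) - (R ^ 2 + a ^ 2) * R ^ 2 * H ^ 2 := rfl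
    linarith
  obtain ⟨r, hr, hfr⟩ := intermediate_value_Ioo' hR.le hf.continuousOn ⟨hneg, hpos⟩
  -- `Δ_Λ` does not depend on `θ`, so any angle in `(0, π)` would do; the open interval in the
  -- previous step gives `r > 0`.
  refine ⟨![0, r, Real.pi / 2, 0], ⟨hr.1, ?_, ?_⟩, hfr⟩
  · simpa using Real.pi_div_two_pos
  · simpa using Real.pi_pos

end KerrVaidyaDeSitter

open ChartGeometry KerrVaidyaDeSitter in
theorem mainTheorem5 (Λ a : ℝ) (hΛ : 0 < Λ) (M : ℝ → ℝ) (hM : ContDiff ℝ 3 M) :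
    -- `K = ∂/∂v` is divergence-free
    (∀ x ∈ domain, divergence (metric Λ a M) kodamaField x = 0) ∧
    -- `K` is tangent to the surfaces of constant `r`
    (∀ x ∈ domain, derivAlong kodamaField (fun y => y 1) x = 0) ∧
    -- the current `J^a = G^{ab} K_b` is differentiable and covariantly conserved
    (∀ x ∈ domain,
      DifferentiableAt ℝ (einsteinCurrent (metric Λ a M) kodamaField) x ∧
      divergence (metric Λ a M) (einsteinCurrent (metric Λ a M) kodamaField) x = 0) ∧
    -- causal character of `K`
    (∀ x ∈ domain,
      (normSq (metric Λ a M) kodamaField x < 0 ↔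
        Theta Λ a x * a ^ 2 * Real.sin (x 2) ^ 2 < DeltaL Λ a M x) ∧
      (normSq (metric Λ a M) kodamaField x = 0 ↔
        DeltaL Λ a M x = Theta Λ a x * a ^ 2 * Real.sin (x 2) ^ 2)) ∧
    -- ergo-like region: for `a ≠ 0`, `K` is spacelike on `Δ_Λ = 0`, and the two loci differ
    (a ≠ 0 →
      (∀ x ∈ domain, DeltaL Λ a M x = 0 → 0 < normSq (metric Λ a M) kodamaField x) ∧
      {x ∈ domain | normSq (metric Λ a M) kodamaField x = 0} ≠
        {x ∈ domain | DeltaL Λ a M x = 0}) := by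
  have hpos : ∀ x ∈ domain, 0 < rhoSq a x * Zc Λ a ^ 2 := fun x hx =>
    mul_pos (rhoSq_pos hx) (pow_pos Zc_pos 2)
  have hspace : a ≠ 0 → ∀ x ∈ domain, DeltaL Λ a M x = 0 →
      0 < normSq (metric Λ a M) kodamaField x := by
    intro ha x hx hD
    have hs := sin_pos_of_mem hx
    have hT := Theta_pos (Λ := Λ) (a := a) (x := x)
    rw [normSq_kodamaField, hD, sub_zero]
    exact div_pos (by positivity) (hpos x hx)
  refine ⟨fun x hx => divergence_kodamaField hM hx, fun x _ => derivAlong_kodamaField,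
    fun x hx => ⟨(isMetricOn_metric hM).differentiableAt_einsteinCurrent_single hx 0,
      divergence_einsteinCurrent_kodamaField hM hx⟩, fun x hx => ⟨?_, ?_⟩,
    fun ha => ⟨hspace ha, fun h => ?_⟩⟩
  · rw [normSq_kodamaField, div_lt_iff₀ (hpos x hx), zero_mul, sub_neg]
  · rw [normSq_kodamaField, div_eq_zero_iff, or_iff_left (hpos x hx).ne', sub_eq_zero, eq_comm]
  -- Positivity of the norm on `Δ_Λ = 0` separates the two sets only because that locus is nonempty;
  -- two empty sets would coincide.
  · obtain ⟨x, hx, hD⟩ := exists_DeltaL_eq_zero hΛ ha M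
    have hmem : x ∈ {x ∈ domain | normSq (metric Λ a M) kodamaField x = 0} := by
      rw [h]
      exact ⟨hx, hD⟩
    exact (hspace ha x hx hD).ne' hmem.2
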